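/- Let $N=\{1,\dots,n\}$ and let $\mathcal I\subseteq 2^N$ be an independence system ($\emptyset\in\mathcal I$, and $\mathcal I$ is closed under taking subsets). Let $p\ge 2$ and $q\ge 1$ be integers. Assume that $\mathcal I$ is one of the following. * A *$p$-matroid intersection*: $\mathcal I$ is the intersection of the independence families of $p$ matroids on $N$. Then a set $Y\in\mathcal I$ is called *$q$-reachable* from $X\in\mathcal I$ if $|Y\setminus X|\le 2q$ and $|X\setminus Y|\le 2pq$, and we put $t=2q(p+1)$. * A *$p$-exchange system*: for all $S,S'\in\mathcal I$ there is a map $\varphi\colon S'\setminus S\to 2^{S\setminus S'}$ such that $|\varphi(v)|\le p$ for all $v$, each element of $S\setminus S'$ lies in at most $p$ of the sets $\varphi(v)$, and $(S\setminus\bigcup_{v\in Z}\varphi(v))\cup Z\in\mathcal I$ for all $Z\subseteq S'\setminus S$. Then $Y\in\mathcal I$ is called *$q$-reachable* from $X\in\mathcal I$ if $|Y\setminus X|\le q$ and $|X\setminus Y|\le pq-q+1$, and we put $t=pq+1$. Let $\mathcal F_q(X)$ be the family of all sets that are $q$-reachable from $X$, and let $s=\max\{|X| : X\in\mathcal I\}$;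 assume $s\ge 1$. Let $u\colon\mathbb R^n\to\mathbb R$ be continuously differentiable with $u(\mathbf 0)\ge 0$. Let $m_{2s}>0$ and $M_{s,t}$ be real numbers such that $$u(\mathbf y)-u(\mathbf x)-\langle\nabla u(\mathbf x),\mathbf y-\mathbf x\rangle\le-\tfrac{m_{2s}}2\|\mathbf y-\mathbf x\|_2^2$$ whenever each of $\mathbf x$, $\mathbf y$, $\mathbf x-\mathbf y$ has at most $2s$ non-zero coordinates, and $$u(\mathbf y)-u(\mathbf x)-\langle\nabla u(\mathbf x),\mathbf y-\mathbf x\rangle\ge-\tfrac{M_{s,t}}2\|\mathbf y-\mathbf x\|_2^2$$ whenever $\mathbf x$ and $\mathbf y$ have at most $s$ non-zero coordinates each and $\mathbf x-\mathbf y$ has at most $t$. For $X\subseteq N$ let $f(X)=\max_{\mathrm{supp}(\mathbf w)\subseteq X}u(\mathbf w)$, and let $\mathbf w^{(X)}$ be the (unique) maximizer; these exist for all $X$ with $|X|\le 2s$. For a vector $\mathbf v$ and a set $A\subseteq N$ write $\|\mathbf v_A\|^2=\sum_{i\in A}\mathbf v_i^2$. Consider the following local search algorithm. Start with any $X\in\mathcal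 I$. Repeat at most $T$ times: select a set $X'\in\mathcal F_q(X)$ by the rule below; if the test below succeeds, replace $X$ by $X'$, otherwise stop and return $X$. After $T$ iterations return $X$. Ties are broken arbitrarily. * *Semi-oblivious variant.* Take a map $\phi_X\colon 2^N\to 2^X$ such that, for every $S$ for which some $A\subseteq X$ satisfies $(X\cup S)\setminus A\in\mathcal F_q(X)$, the set $\phi_X(S)$ minimizes $\|(\mathbf w^{(X)})_A\|^2$ among all such $A$. Select $X'$ maximizing $f(X')$ among all members of $\mathcal F_q(X)$ of the form $(X\cup S)\setminus\phi_X(S)$. The test is $f(X')-f(X)>0$. * *Non-oblivious variant.* Put $$g_X(X')=\frac1{2M_{s,t}}\bigl\|(\nabla u(\mathbf w^{(X)}))_{X'\setminus X}\bigr\|^2-\frac{M_{s,t}}2\bigl\|(\mathbf w^{(X)})_{X\setminus X'}\bigr\|^2 .$$ Select $X'\in\mathcal F_q(X)$ maximizing $g_X(X')$. The test is $g_X(X')>0$. **Theorem.** Let $X^*$ maximize $f$ over $\mathcal I$. For both kinds of constraint, both variants, every $T\ge 0$ and every output $X$ of the algorithm with at most $T$ iterations, $$f(X)\ \ge\ \frac1{p-1+1/q}\,\frac{m_{2s}^2}{M_{s,t}^2}\left(1-\exp\left(-\frac{(p-1+1/q)\,M_{s,t}\,T}{s\,m_{2s}}\right)\right)f(X^*).$$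 If $X$ is returned because the test failed (a local optimum), then $$f(X)\ \ge\ \frac1{p-1+1/q}\,\frac{m_{2s}^2}{M_{s,t}^2}\,f(X^*).$$ -/

import Mathlib

noncomputable section

namespace SparseLocalSearch

/-! ### Independence systems, matroid intersections, exchange systems -/

/-- `I` is an independence system on the ground set `{1, …, n}` (here `Fin n`). -/
def IsIndependenceSystem {n : ℕ} (I : Set (Finset (Fin n))) : Prop :=
  ∅ ∈ I ∧ ∀ X Y : Finset (Fin n), X ⊆ Y → Y ∈ I → X ∈ I

/-- `I` is the intersection of the independence families of `p` matroids on the ground set. -/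
def IsMatroidIntersection {n : ℕ} (p : ℕ) (I : Set (Finset (Fin n))) : Prop :=
  IsIndependenceSystem I ∧
    ∃ 𝓜 : Fin p → Matroid (Fin n), (∀ i, (𝓜 i).E = Set.univ) ∧
      ∀ X : Finset (Fin n), X ∈ I ↔ ∀ i, (𝓜 i).Indep (X : Set (Fin n))

/-- `p`-exchange systems. Only the values of `φ` on `T \ S` matter. -/
def IsExchangeSystem {n : ℕ} (p : ℕ) (I : Set (Finset (Fin n))) : Prop :=
  IsIndependenceSystem I ∧
    ∀ S ∈ I, ∀ T ∈ I, ∃ φ : Fin n → Finset (Fin n),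
      (∀ v ∈ T \ S, φ v ⊆ S \ T) ∧
      (∀ v ∈ T \ S, (φ v).card ≤ p) ∧
      (∀ v ∈ S \ T, ((T \ S).filter (fun x => v ∈ φ x)).card ≤ p) ∧
      (∀ X ⊆ T \ S, (S \ X.biUnion φ) ∪ X ∈ I)

/-- The two classes of constraints. -/
inductive ConstraintKind
  | matroidIntersection
  | exchangeSystem

/-- `I` is a `p`-matroid intersection, respectively a `p`-exchange system. -/
def ConstraintKind.Holds {n : ℕ} (κ : ConstraintKind) (p : ℕ) (I : Set (Finset (Fin n))) : Prop :=
  match κ with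
  | .matroidIntersection => IsMatroidIntersection p I
  | .exchangeSystem => IsExchangeSystem p I

/-- How many elements may be added in one `q`-exchange. -/
def ConstraintKind.maxAdd (κ : ConstraintKind) (q : ℕ) : ℕ :=
  match κ with
  | .matroidIntersection => 2 * q
  | .exchangeSystem => q

/-- How many elements may be removed in one `q`-exchange. -/
def ConstraintKind.maxRemove (κ : ConstraintKind) (p q : ℕ) : ℕ :=
  match κ with
  | .matroidIntersection => 2 * p * q
  | .exchangeSystem => p * q - q + 1

/-- The exchange size `t`: the largest possible size of the symmetric difference of a set and a
set that is `q`-reachable from it. -/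
def ConstraintKind.exchangeSize (κ : ConstraintKind) (p q : ℕ) : ℕ :=
  match κ with
  | .matroidIntersection => 2 * q * (p + 1)
  | .exchangeSystem => p * q + 1

/-- The family `F_q(X)` of the feasible sets that are `q`-reachable from `X`. -/
def reachable {n : ℕ} (κ : ConstraintKind) (p q : ℕ) (I : Set (Finset (Fin n)))
    (X : Finset (Fin n)) : Set (Finset (Fin n)) :=
  {Y | Y ∈ I ∧ (Y \ X).card ≤ κ.maxAdd q ∧ (X \ Y).card ≤ κ.maxRemove p q}

/-! ### Restricted strong concavity and restricted smoothness -/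

/-- The set of the non-zero coordinates of `w`. -/
def supp {n : ℕ} (w : EuclideanSpace ℝ (Fin n)) : Finset (Fin n) :=
  Finset.univ.filter (fun i => w i ≠ 0)

/-- The domain `Ω_{s,t}`. -/
def Omega (n s t : ℕ) : Set (EuclideanSpace ℝ (Fin n) × EuclideanSpace ℝ (Fin n)) :=
  {z | (supp z.1).card ≤ s ∧ (supp z.2).card ≤ s ∧ (supp (z.1 - z.2)).card ≤ t}

/-- `u` is restricted strongly concave with parameter `m` on `Ω`. -/
def RestrictedStronglyConcave {n : ℕ} (u : EuclideanSpace ℝ (Fin n) → ℝ) (m : ℝ)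
    (Ω : Set (EuclideanSpace ℝ (Fin n) × EuclideanSpace ℝ (Fin n))) : Prop :=
  ∀ x y, (x, y) ∈ Ω →
    u y - u x - inner ℝ (gradient u x) (y - x) ≤ -(m / 2) * ‖y - x‖ ^ 2

/-- `u` is restricted smooth with parameter `M` on `Ω`. -/
def RestrictedSmooth {n : ℕ} (u : EuclideanSpace ℝ (Fin n) → ℝ) (M : ℝ)
    (Ω : Set (EuclideanSpace ℝ (Fin n) × EuclideanSpace ℝ (Fin n))) : Prop :=
  ∀ x y, (x, y) ∈ Ω →
    -(M / 2) * ‖y - x‖ ^ 2 ≤ u y - u x - inner ℝ (gradient u x) (y - x)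

/-! ### The set function of sparse optimization -/

/-- The vectors whose support is contained in `X`. -/
def supportedOn {n : ℕ} (X : Finset (Fin n)) : Set (EuclideanSpace ℝ (Fin n)) :=
  {w | supp w ⊆ X}

/-- `f(X)`, the maximum of `u` over the vectors supported on `X`. -/
def sparseObjective {n : ℕ} (u : EuclideanSpace ℝ (Fin n) → ℝ) (X : Finset (Fin n)) : ℝ :=
  sSup (u '' supportedOn X)

/-- `w^(X)`, the maximizer of `u` over the vectors supported on `X`. Restricted strong concavity
makes it exist and be unique for all the sets `X` that are used. -/
def maximizer {n : ℕ} (u : EuclideanSpace ℝ (Fin n) → ℝ) (X : Finset (Fin n)) :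
    EuclideanSpace ℝ (Fin n) :=
  Classical.epsilon (fun w => w ∈ supportedOn X ∧ IsMaxOn u (supportedOn X) w)

/-- `‖w_X‖²`, where `w_X` is the restriction of `w` to the coordinates in `X`. -/
def normSqOn {n : ℕ} (w : EuclideanSpace ℝ (Fin n)) (X : Finset (Fin n)) : ℝ :=
  ∑ i ∈ X, w i ^ 2

/-! ### The two local search algorithms -/

/-- The two accelerated variants. -/
inductive Variant
  | semiOblivious
  | nonOblivious

/-- The surrogate for the gain `f(X') - f(X)` used by the non-oblivious variant. -/
def score {n : ℕ} (u : EuclideanSpace ℝ (Fin n) → ℝ) (M : ℝ) (X X' : Finset (Fin n)) : ℝ :=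
  1 / (2 * M) * normSqOn (gradient u (maximizer u X)) (X' \ X)
    - M / 2 * normSqOn (maximizer u X) (X \ X')

/-- `φ` assigns to every set `S` of elements to be added a set `φ S ⊆ X` of elements to be removed
that minimizes `‖(w^(X))_{φ S}‖²` among all the sets `T ⊆ X` for which `(X ∪ S) \ T` is
`q`-reachable from `X` (if there is such a `T`). -/
def IsRemovalRule {n : ℕ} (u : EuclideanSpace ℝ (Fin n) → ℝ) (F : Set (Finset (Fin n)))
    (X : Finset (Fin n)) (φ : Finset (Fin n) → Finset (Fin n)) : Prop :=
  (∀ S, φ S ⊆ X) ∧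
    ∀ S, ∀ T ⊆ X, (X ∪ S) \ T ∈ F →
      (X ∪ S) \ φ S ∈ F ∧ normSqOn (maximizer u X) (φ S) ≤ normSqOn (maximizer u X) T

/-- In one iteration with current solution `X`, the variant may select `X'`
(`F` is the family of the sets that are `q`-reachable from `X`; ties are broken arbitrarily). -/
def Variant.Selects {n : ℕ} (a : Variant) (u : EuclideanSpace ℝ (Fin n) → ℝ) (M : ℝ)
    (F : Set (Finset (Fin n))) (X X' : Finset (Fin n)) : Prop :=
  match a with
  | .semiOblivious => ∃ φ : Finset (Fin n) → Finset (Fin n), IsRemovalRule u F X φ ∧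
      (X' ∈ F ∧ ∃ S, X' = (X ∪ S) \ φ S) ∧
      ∀ Y ∈ F, (∃ S, Y = (X ∪ S) \ φ S) → sparseObjective u Y ≤ sparseObjective u X'
  | .nonOblivious => X' ∈ F ∧ ∀ Y ∈ F, score u M X Y ≤ score u M X X'

/-- The test that decides whether the selected set `X'` replaces the current solution `X`. -/
def Variant.Improves {n : ℕ} (a : Variant) (u : EuclideanSpace ℝ (Fin n) → ℝ) (M : ℝ)
    (X X' : Finset (Fin n)) : Prop :=
  match a with
  | .semiOblivious => sparseObjective u X' - sparseObjective u X > 0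
  | .nonOblivious => score u M X X' > 0

/-- How the algorithm ended: all the iterations were used, or the selected set failed the test. -/
inductive Outcome
  | exhausted
  | stopped

/-- `LocalSearch a κ p q I u M T X₀ X o`: the algorithm, run for (at most) `T` iterations with
initial solution `X₀`, can return `X` with outcome `o`. -/
inductive LocalSearch {n : ℕ} (a : Variant) (κ : ConstraintKind) (p q : ℕ)
    (I : Set (Finset (Fin n))) (u : EuclideanSpace ℝ (Fin n) → ℝ) (M : ℝ) :
    ℕ → Finset (Fin n) → Finset (Fin n) → Outcome → Prop
  | finish (X : Finset (Fin n)) : LocalSearch a κ p q I u M 0 X X Outcome.exhausted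
  | halt (T : ℕ) (X X' : Finset (Fin n))
      (hsel : a.Selects u M (reachable κ p q I X) X X') (himp : ¬ a.Improves u M X X') :
      LocalSearch a κ p q I u M (T + 1) X X Outcome.stopped
  | step (T : ℕ) (X X' Y : Finset (Fin n)) (o : Outcome)
      (hsel : a.Selects u M (reachable κ p q I X) X X') (himp : a.Improves u M X X')
      (hrest : LocalSearch a κ p q I u M T X' Y o) :
      LocalSearch a κ p q I u M (T + 1) X Y o

end SparseLocalSearch

end

open SparseLocalSearch

set_option linter.unusedSectionVars false

/-! Write r = p - 1 + 1/q. The core is an averaging argument. For X, Y in I there are exchanges (A,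
B), each leading to a set reachable from X, with nonnegative weights for which every element of Y \
X is added with total weight exactly q, while the total weighted cost of the removals is at most (p
- 1)q + 1 = qr times the cost of X \ Y, for a prescribed nonnegative cost on elements
(`cheapFamily_reachable`). The cost used is the squared coordinate of the maximizer w on X.

For a p-matroid intersection, two of the matroids are treated together. Single exchanges give a
permutation for each of them. When both matchings are unique, windows of length q along the cycles
of σ₂⁻¹σ₁ can be exchanged simultaneously, at a removal weight of q + 1. The general case is a
nonnegative combination of this one (`good_of_matchings`). Each other matroid contributes a further
q through a greedy weighted exchange (`exists_matroid_removal`), and (q + 1) + (p - 2)q = (p - 1)q +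
1. For an exchange system, two permutations along the edges of the bipartite graph of φ play the
role of σ₁ and σ₂; consecutive points of a window share a neighbour, which saves one removal per
step (`cheapFamily_of_degree_le`).

On the analytic side the gradient vanishes on X at w. Smoothness makes the score a lower bound for
the true gain (`add_score_le_sparseObjective`); strong concavity bounds f(Y) - f(X) by the squared
gradient on Y \ X minus the squared w on X \ Y (`sparseObjective_le_add`), and u(0) ≥ 0 gives
(m/2)‖w‖² ≤ f(X) on any coordinates. Averaging the scores over the family yields (m/M) f(Y) - r(M/m)
f(X) ≤ s · gain (`Variant.Selects.progress`). With C = m² f(X*)/(rM²), one iteration therefore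
contracts the deficit C - f(X) by the factor 1 - rM/(sm) ≤ exp(-rM/(sm)), and a failed test forces
the deficit to be nonpositive. -/

namespace SparseLocalSearch

/-! ### Weighted windows along the cycles of a permutation -/

section Windows

variable {V : Type*} [Fintype V] [DecidableEq V]

/-- The first `k` points `v, τ v, …, τ ^ (k - 1) v` of the orbit of `v`. -/
def orbitWindow (τ : Equiv.Perm V) (k : ℕ) (v : V) : Finset V :=
  (Finset.range k).image fun j => (τ ^ j) v

lemma mem_orbitWindow {τ : Equiv.Perm V} {k : ℕ} {v x : V} :
    x ∈ orbitWindow τ k v ↔ ∃ j < k, (τ ^ j) v = x := by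
  simp [orbitWindow]

lemma card_orbitWindow_le (τ : Equiv.Perm V) (k : ℕ) (v : V) :
    (orbitWindow τ k v).card ≤ k :=
  Finset.card_image_le.trans (by simp)

lemma orbitWindow_subset {τ : Equiv.Perm V} {S : Finset V} (hS : ∀ x ∈ S, τ x ∈ S) (k : ℕ)
    {v : V} (hv : v ∈ S) : orbitWindow τ k v ⊆ S := by
  intro x hx
  obtain ⟨j, -, rfl⟩ := mem_orbitWindow.1 hx
  clear hx
  induction j with
  | zero => simpa
  | succ j ih => rw [pow_succ', Equiv.Perm.mul_apply]; exact hS _ ih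

lemma mem_orbitWindow_inv {τ : Equiv.Perm V} {k : ℕ} {v x : V} :
    x ∈ orbitWindow τ k v ↔ v ∈ orbitWindow τ⁻¹ k x := by
  simp only [mem_orbitWindow]
  refine exists_congr fun j => and_congr_right fun _ => ?_
  rw [inv_pow, Equiv.Perm.inv_eq_iff_eq, eq_comm]

lemma minimalPeriod_perm_pos (τ : Equiv.Perm V) (v : V) : 0 < Function.minimalPeriod τ v :=
  Function.minimalPeriod_pos_of_mem_periodicPts (τ.injective.mem_periodicPts v)

lemma minimalPeriod_perm_inv (τ : Equiv.Perm V) (v : V) :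
    Function.minimalPeriod (τ⁻¹ : Equiv.Perm V) v = Function.minimalPeriod τ v := by
  rw [Function.minimalPeriod_eq_minimalPeriod_iff]
  intro k
  simp only [Function.IsPeriodicPt, Function.IsFixedPt, Equiv.Perm.iterate_eq_pow]
  rw [inv_pow, Equiv.Perm.inv_eq_iff_eq, eq_comm]

lemma minimalPeriod_perm_pow (τ : Equiv.Perm V) (j : ℕ) (v : V) :
    Function.minimalPeriod τ ((τ ^ j) v) = Function.minimalPeriod τ v := by
  rw [← Equiv.Perm.iterate_eq_pow]
  exact Function.minimalPeriod_apply_iterate (τ.injective.mem_periodicPts v) j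

lemma card_orbitWindow (τ : Equiv.Perm V) (k : ℕ) (v : V) :
    (orbitWindow τ k v).card = min k (Function.minimalPeriod τ v) := by
  have key : ∀ l ≤ Function.minimalPeriod τ v, (orbitWindow τ l v).card = l := by
    intro l hl
    rw [orbitWindow, Finset.card_image_of_injOn, Finset.card_range]
    intro i hi j hj hij
    simp only [Finset.coe_range, Set.mem_Iio] at hi hj
    simp only [← Equiv.Perm.iterate_eq_pow] at hij
    exact Function.iterate_injOn_Iio_minimalPeriod (hi.trans_le hl) (hj.trans_le hl) hij
  rcases le_total k (Function.minimalPeriod τ v) with h | h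
  · rw [key k h, min_eq_left h]
  · rw [min_eq_right h]
    have : orbitWindow τ k v = orbitWindow τ (Function.minimalPeriod τ v) v := by
      ext x
      simp only [mem_orbitWindow]
      constructor
      · rintro ⟨j, -, rfl⟩
        refine ⟨j % Function.minimalPeriod τ v, Nat.mod_lt _ (minimalPeriod_perm_pos τ v), ?_⟩
        rw [← Equiv.Perm.iterate_eq_pow, ← Equiv.Perm.iterate_eq_pow,
          Function.iterate_mod_minimalPeriod_eq]
      · rintro ⟨j, hj, rfl⟩
        exact ⟨j, hj.trans_le h, rfl⟩
    rw [this, key _ le_rfl]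

/-- The weight that makes the windows of length `q` cover every point exactly `q` times. -/
noncomputable def windowWeight (τ : Equiv.Perm V) (q : ℕ) (v : V) : ℝ :=
  (q : ℝ) / (min q (Function.minimalPeriod τ v) : ℕ)

lemma windowWeight_nonneg (τ : Equiv.Perm V) (q : ℕ) (v : V) : 0 ≤ windowWeight τ q v := by
  unfold windowWeight; positivity

lemma sum_windowWeight_inv (τ : Equiv.Perm V) (q k : ℕ) (x : V) :
    ∑ v ∈ orbitWindow τ⁻¹ k x, windowWeight τ q v =
      (min k (Function.minimalPeriod τ x) : ℕ) * windowWeight τ q x := by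
  rw [Finset.sum_congr rfl (g := fun _ => windowWeight τ q x), Finset.sum_const, nsmul_eq_mul,
    card_orbitWindow, minimalPeriod_perm_inv]
  intro v hv
  obtain ⟨j, -, rfl⟩ := mem_orbitWindow.1 hv
  have := minimalPeriod_perm_pow τ⁻¹ j x
  rw [minimalPeriod_perm_inv, minimalPeriod_perm_inv] at this
  rw [windowWeight, windowWeight, this]

/-- The windows through x start in the backward window of x, which has min q L points, where L is
the period of x. The period is constant along the orbit, so each of these windows has weight q / min
q L; this is what corrects for cycles shorter than q. -/
lemma sum_windowWeight {q : ℕ} (hq : 1 ≤ q) (τ : Equiv.Perm V) (x : V) :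
    ∑ v, (if x ∈ orbitWindow τ q v then windowWeight τ q v else 0) = q := by
  simp only [mem_orbitWindow_inv (τ := τ)]
  rw [Finset.sum_ite_mem, Finset.univ_inter, sum_windowWeight_inv, windowWeight]
  have := minimalPeriod_perm_pos τ x
  have : (0 : ℝ) < (min q (Function.minimalPeriod τ x) : ℕ) := by
    exact_mod_cast lt_min (by omega) this
  field_simp

/-- A window meeting {x, τ x} starts in the backward window of length q + 1 from τ x. If L > q these
q + 1 starts have weight 1; if L ≤ q there are L of them with weight q / L. Thus two consecutive
points cost q + 1 rather than 2q, and this is the whole saving of the exchange argument. -/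
lemma sum_windowWeight_consecutive {q : ℕ} (hq : 1 ≤ q) (τ : Equiv.Perm V) (x : V) :
    ∑ v, (if x ∈ orbitWindow τ q v ∨ τ x ∈ orbitWindow τ q v then windowWeight τ q v else 0)
      ≤ q + 1 := by
  have hL := minimalPeriod_perm_pos τ x
  calc _ ≤ ∑ v, (if v ∈ orbitWindow τ⁻¹ (q + 1) (τ x) then windowWeight τ q v else 0) := by
        refine Finset.sum_le_sum fun v _ => ?_
        by_cases h : x ∈ orbitWindow τ q v ∨ τ x ∈ orbitWindow τ q v
        · rw [if_pos h, if_pos]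
          rw [← mem_orbitWindow_inv, mem_orbitWindow]
          rcases h with h | h
          · obtain ⟨j, hj, rfl⟩ := mem_orbitWindow.1 h
            exact ⟨j + 1, by omega, by rw [pow_succ', Equiv.Perm.mul_apply]⟩
          · obtain ⟨j, hj, hx⟩ := mem_orbitWindow.1 h
            exact ⟨j, by omega, hx⟩
        · rw [if_neg h]
          split_ifs
          · exact windowWeight_nonneg τ q v
          · exact le_rfl
    _ = (min (q + 1) (Function.minimalPeriod τ x) : ℕ) * windowWeight τ q x := by
        rw [Finset.sum_ite_mem, Finset.univ_inter, sum_windowWeight_inv]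
        have := minimalPeriod_perm_pow τ 1 x
        rw [pow_one] at this
        rw [windowWeight, windowWeight, this]
    _ ≤ q + 1 := by
        rw [windowWeight]
        rcases Nat.lt_or_ge q (Function.minimalPeriod τ x) with h | h
        · rw [min_eq_left (by omega), min_eq_left h.le]
          have : (q : ℝ) ≠ 0 := by positivity
          rw [div_self this]; push_cast; linarith
        · rw [min_eq_right (by omega), min_eq_right h]
          have : (Function.minimalPeriod τ x : ℝ) ≠ 0 := by positivity
          rw [mul_div_cancel₀ _ this]; linarith

end Windows

/-! ### Unique perfect matchings and reduction to them -/

section Matchings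

variable {V : Type*} [DecidableEq V]

/-- A map of a nonempty finite set to itself permutes a nonempty subset. -/
lemma exists_image_eq_self (h : V → V) (D : Finset V) (hD : D.Nonempty)
    (hmap : ∀ x ∈ D, h x ∈ D) : ∃ S ⊆ D, S.Nonempty ∧ S.image h = S := by
  induction D using Finset.strongInduction with
  | H D ih =>
    have hsub : D.image h ⊆ D := Finset.image_subset_iff.2 hmap
    by_cases heq : D.image h = D
    · exact ⟨D, subset_rfl, hD, heq⟩
    · obtain ⟨S, hS, hne, him⟩ := ih _ (hsub.ssubset_of_ne heq) (hD.image h)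
        (fun x hx => Finset.mem_image_of_mem h (hsub hx))
      exact ⟨S, hS.trans hsub, hne, him⟩

variable [Fintype V]

lemma exists_perm_eqOn (f : V → V) (S R : Finset V) (himg : S.image f = R)
    (hcard : R.card = S.card) : ∃ σ : Equiv.Perm V, ∀ i ∈ S, σ i = f i := by
  have hinj : Set.InjOn f S := Finset.card_image_iff.1 (by rw [himg, hcard])
  obtain ⟨g, hg⟩ := Finset.exists_equiv_extend_of_card_eq (t := Finset.univ) (s := S) (f := f)
    (by simp) (by simp) hinj
  exact ⟨g.trans (Equiv.subtypeUnivEquiv (by simp)), fun i hi => by simp [hg i hi]⟩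

lemma image_perm_congr {σ σ' : V → V} {S : Finset V} (h : ∀ i ∈ S, σ i = σ' i) :
    S.image σ = S.image σ' := Finset.image_congr (fun i hi => h i hi)

/-- `σ` is the only perfect matching in the relation `E` between `S` and `σ S`. -/
def IsUniqueMatching (E : V → V → Prop) (S : Finset V) (σ : Equiv.Perm V) : Prop :=
  ∀ σ' : Equiv.Perm V, S.image σ' = S.image σ → (∀ i ∈ S, E i (σ' i)) → ∀ i ∈ S, σ' i = σ i

/-- Otherwise every i in K has an edge to σ (g i) with g i ≠ i in K. The map g permutes a nonempty
subset L, and rerouting i to σ (g i) on L gives a second perfect matching. -/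
lemma IsUniqueMatching.exists_source {E : V → V → Prop} {S : Finset V} {σ : Equiv.Perm V}
    (h : IsUniqueMatching E S σ) (hE : ∀ i ∈ S, E i (σ i)) {K : Finset V} (hK : K ⊆ S)
    (hne : K.Nonempty) : ∃ i ∈ K, ∀ j ∈ K, j ≠ i → ¬ E i (σ j) := by
  classical
  by_contra! hcon
  choose! g hg using hcon
  obtain ⟨L, hLK, hLne, hL⟩ := exists_image_eq_self g K hne (fun x hx => (hg x hx).1)
  have himg : S.image (fun x => if x ∈ L then σ (g x) else σ x) = S.image σ := by
    ext y
    simp only [Finset.mem_image]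
    constructor
    · rintro ⟨x, hx, rfl⟩
      by_cases hxL : x ∈ L
      · exact ⟨g x, hK (hg x (hLK hxL)).1, by simp [hxL]⟩
      · exact ⟨x, hx, by simp [hxL]⟩
    · rintro ⟨x, hx, rfl⟩
      by_cases hxL : x ∈ L
      · rw [← hL] at hxL
        obtain ⟨z, hz, rfl⟩ := Finset.mem_image.1 hxL
        exact ⟨z, hK (hLK hz), by simp [hz]⟩
      · exact ⟨x, hx, by simp [hxL]⟩
  obtain ⟨σ', hσ'⟩ := exists_perm_eqOn _ S (S.image σ) himg
    (Finset.card_image_of_injective _ σ.injective)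
  obtain ⟨x, hx⟩ := hLne
  have hxK := hLK hx
  have h1 := h σ' ((image_perm_congr hσ').trans himg) (fun i hi => by
    rw [hσ' i hi]
    split_ifs with hiL
    · exact (hg i (hLK hiL)).2.2
    · exact hE i hi) x (hK hxK)
  rw [hσ' x (hK hxK), if_pos hx] at h1
  exact (hg x hxK).2.1 (σ.injective h1)

lemma sum_graph_row (S : Finset V) (f : V → V) (i : V) :
    ∑ j, (if i ∈ S ∧ f i = j then 1 else 0) = if i ∈ S then 1 else 0 := by
  by_cases hi : i ∈ S <;> simp [hi]

lemma sum_graph_col {S : Finset V} {f : V → V} (hS : S.image f = S) (j : V) :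
    ∑ i, (if i ∈ S ∧ f i = j then 1 else 0) = if j ∈ S then 1 else 0 := by
  have hinj : Set.InjOn f S := Finset.card_image_iff.1 (by rw [hS])
  by_cases hj : j ∈ S
  · obtain ⟨i, hi, rfl⟩ := Finset.mem_image.1 (hS.symm ▸ hj)
    rw [if_pos hj, Finset.sum_eq_single i]
    · simp [hi]
    · intro k _ hk
      rw [if_neg]
      rintro ⟨hkS, he⟩
      exact hk (hinj hkS hi he)
    · simp
  · rw [if_neg hj]
    refine Finset.sum_eq_zero fun i _ => ?_
    rw [if_neg]
    rintro ⟨hi, rfl⟩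
    exact hj (hS ▸ Finset.mem_image_of_mem f hi)

/-- A nonnegative integer matrix with equal row and column sums is a sum of permutations of
subsets. -/
lemma exists_list_of_balanced (N : ℕ) : ∀ Q : V → V → ℕ, (∑ i, ∑ j, Q i j = N) →
    (∀ i, ∑ j, Q i j = ∑ j, Q j i) →
    ∃ L : List (Finset V),
      (∀ S ∈ L, S.Nonempty ∧ ∃ ρ : V → V, S.image ρ = S ∧ ∀ i ∈ S, 0 < Q i (ρ i)) ∧
      ∀ i, (L.map fun S => if i ∈ S then 1 else 0).sum = ∑ j, Q i j := by
  classical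
  induction N using Nat.strong_induction_on with
  | _ N ih =>
  intro Q hN hbal
  by_cases hzero : ∀ i, ∑ j, Q i j = 0
  · exact ⟨[], by simp, fun i => by simp [hzero i]⟩
  push Not at hzero
  obtain ⟨i₀, hi₀⟩ := hzero
  set D : Finset V := Finset.univ.filter fun i => ∑ j, Q i j ≠ 0 with hD
  have hex : ∀ i ∈ D, ∃ j, 0 < Q i j := by
    intro i hi
    simp only [hD, Finset.mem_filter, Finset.mem_univ, true_and] at hi
    obtain ⟨j, -, hj⟩ := Finset.exists_ne_zero_of_sum_ne_zero hi
    exact ⟨j, Nat.pos_of_ne_zero hj⟩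
  choose! ρ hρ using hex
  -- Following positive entries never leaves D: the vertex reached has a positive column sum, hence
  -- a positive row sum by balance. So ρ permutes some nonempty S, whose graph is subtracted from Q.
  obtain ⟨S, hSD, hSne, hS⟩ := exists_image_eq_self ρ D ⟨i₀, Finset.mem_filter.2 ⟨Finset.mem_univ _, hi₀⟩⟩ (by
    intro i hi
    simp only [hD, Finset.mem_filter, Finset.mem_univ, true_and]
    rw [hbal]
    have := Finset.single_le_sum (f := fun j => Q j (ρ i)) (fun _ _ => Nat.zero_le _)
      (Finset.mem_univ i)
    have := hρ i hi
    omega)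
  set δ : V → V → ℕ := fun i j => if i ∈ S ∧ ρ i = j then 1 else 0 with hδ
  have hδle : ∀ i j, δ i j ≤ Q i j := by
    intro i j
    simp only [hδ]
    split_ifs with h
    · obtain ⟨hi, rfl⟩ := h
      exact hρ i (hSD hi)
    · exact Nat.zero_le _
  have hrow : ∀ i, ∑ j, δ i j = if i ∈ S then 1 else 0 := sum_graph_row S ρ
  have hcol : ∀ j, ∑ i, δ i j = if j ∈ S then 1 else 0 := sum_graph_col hS
  have hrow' : ∀ i, ∑ j, (Q i j - δ i j) + (if i ∈ S then 1 else 0) = ∑ j, Q i j := by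
    intro i
    rw [← hrow i, ← Finset.sum_add_distrib]
    exact Finset.sum_congr rfl fun j _ => Nat.sub_add_cancel (hδle i j)
  have hcol' : ∀ j, ∑ i, (Q i j - δ i j) + (if j ∈ S then 1 else 0) = ∑ i, Q i j := by
    intro j
    rw [← hcol j, ← Finset.sum_add_distrib]
    exact Finset.sum_congr rfl fun i _ => Nat.sub_add_cancel (hδle i j)
  have hlt : ∑ i, ∑ j, (Q i j - δ i j) < N := by
    rw [← hN]
    obtain ⟨x, hx⟩ := hSne
    refine Finset.sum_lt_sum (fun i _ => ?_) ⟨x, Finset.mem_univ _, ?_⟩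
    · have := hrow' i
      omega
    · have := hrow' x
      simp only [hx, if_true] at this
      omega
  obtain ⟨L, hL, hLsum⟩ := ih _ hlt (fun i j => Q i j - δ i j) rfl (fun i => by
    have h1 := hrow' i
    have h2 := hcol' i
    have h3 := hbal i
    omega)
  refine ⟨S :: L, ?_, fun i => ?_⟩
  · intro S' hS'
    rcases List.mem_cons.1 hS' with rfl | hS'
    · exact ⟨hSne, ρ, hS, fun i hi => hρ i (hSD hi)⟩
    · obtain ⟨hne, ρ', h1, h2⟩ := hL S' hS'
      exact ⟨hne, ρ', h1, fun i hi => (h2 i hi).trans_le (Nat.sub_le _ _)⟩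
  · rw [List.map_cons, List.sum_cons, hLsum, ← hrow' i, add_comm]

/-- The indicator function of a finite set. -/
def ind (S : Finset V) (x : V) : ℝ := if x ∈ S then 1 else 0

lemma ind_image (S : Finset V) (σ : Equiv.Perm V) (x : V) :
    ind (S.image σ) x = ind S (σ.symm x) := by
  unfold ind
  congr 1
  simp only [Finset.mem_image, eq_iff_iff]
  exact ⟨by rintro ⟨y, hy, rfl⟩; simpa, fun h => ⟨_, h, by simp⟩⟩

/-- Copies of S itself are only counted, by k, since nothing is known about them yet; all other sets
of the list are absorbed into the good part φ. -/
lemma sum_list_ind_decompose {Good : (V → ℝ) → (V → ℝ) → Prop} (hzero : Good 0 0)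
    (hadd : ∀ f g f' g', Good f g → Good f' g' → Good (f + f') (g + g'))
    (S : Finset V) (σ : Equiv.Perm V) (L : List (Finset V))
    (hL : ∀ S' ∈ L, S' = S ∨ Good (ind S') (ind (S'.image σ))) :
    ∃ (k : ℕ) (φ : V → ℝ), Good φ (φ ∘ σ.symm) ∧ (∀ x, 0 ≤ φ x) ∧
      ∀ x, (((L.map fun S' => if x ∈ S' then 1 else 0).sum : ℕ) : ℝ) = k * ind S x + φ x := by
  induction L with
  | nil => exact ⟨0, 0, by simpa using hzero, by simp, by simp⟩
  | cons S' L ih =>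
    obtain ⟨k, φ, hφ, hpos, hsum⟩ := ih fun T hT => hL T (List.mem_cons_of_mem _ hT)
    have hcast : ∀ x, (((if x ∈ S' then 1 else 0 : ℕ)) : ℝ) = ind S' x := by
      intro x; unfold ind; split_ifs <;> simp
    rcases hL S' List.mem_cons_self with rfl | hgood
    · refine ⟨k + 1, φ, hφ, hpos, fun x => ?_⟩
      rw [List.map_cons, List.sum_cons, Nat.cast_add, hsum, hcast]
      push_cast; ring
    · refine ⟨k, ind S' + φ, ?_, fun x => ?_, fun x => ?_⟩
      · have : (ind S' + φ) ∘ σ.symm = ind (S'.image σ) + φ ∘ σ.symm := by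
          ext x; simp [ind_image]
        rw [this]
        exact hadd _ _ _ _ hgood hφ
      · have : 0 ≤ ind S' x := by unfold ind; split_ifs <;> simp
        exact add_nonneg this (hpos x)
      · rw [List.map_cons, List.sum_cons, Nat.cast_add, hsum, hcast, Pi.add_apply]
        ring

/-- If S has two matchings with the same image, then 2 · 1_S is a sum of indicators of matched
subsets, at most one of which is S itself. Solving for 1_S writes it as a nonnegative combination of
proper subsets, which are good by `ih`. The reference matching `σ₂` turns matchings into
permutations of S. -/
lemma good_of_two_matchings {Good : (V → ℝ) → (V → ℝ) → Prop} (hzero : Good 0 0)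
    (hadd : ∀ f g f' g', Good f g → Good f' g' → Good (f + f') (g + g'))
    (hsmul : ∀ (c : ℝ) f g, 0 ≤ c → Good f g → Good (c • f) (c • g))
    {E : V → V → Prop} {S : Finset V} {σ σ' σ₂ : Equiv.Perm V}
    (himg : S.image σ = S.image σ₂) (himg' : S.image σ' = S.image σ₂)
    (hE : ∀ i ∈ S, E i (σ i)) (hE' : ∀ i ∈ S, E i (σ' i)) (hne : ∃ s ∈ S, σ' s ≠ σ s)
    (ih : ∀ S' ⊂ S, S'.Nonempty → ∀ ρ : Equiv.Perm V, S'.image ρ = S'.image σ₂ →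
      (∀ i ∈ S', E i (ρ i)) → Good (ind S') (ind (S'.image σ₂))) :
    Good (ind S) (ind (S.image σ₂)) := by
  classical
  obtain ⟨s, hs, hss⟩ := hne
  have hτ : S.image (fun x => σ₂.symm (σ x)) = S := by
    have : S.image (fun x => σ₂.symm (σ x)) = (S.image σ).image σ₂.symm := by
      rw [Finset.image_image]; rfl
    rw [this, himg, Finset.image_image]; simp
  have hτ' : S.image (fun x => σ₂.symm (σ' x)) = S := by
    have : S.image (fun x => σ₂.symm (σ' x)) = (S.image σ').image σ₂.symm := by
      rw [Finset.image_image]; rfl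
    rw [this, himg', Finset.image_image]; simp
  set τ : V → V := fun x => σ₂.symm (σ x) with hτdef
  set τ' : V → V := fun x => σ₂.symm (σ' x) with hτdef'
  -- Mixing the two permutations at the single point s destroys injectivity on S, because τ already
  -- takes the value τ' s at another point. Hence the subset S₁ permuted by h is proper.
  set h : V → V := fun x => if x = s then τ' x else τ x with hh
  have hcases : ∀ x, h x = τ x ∨ h x = τ' x := by
    intro x; simp only [hh]; split_ifs <;> simp
  have hmem : ∀ x ∈ S, h x ∈ S := by
    intro x hx
    rcases hcases x with he | he <;> rw [he]
    · exact hτ ▸ Finset.mem_image_of_mem τ hx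
    · exact hτ' ▸ Finset.mem_image_of_mem τ' hx
  have hnot : S.image h ≠ S := by
    intro heq
    have hinj : Set.InjOn h S := Finset.card_image_iff.1 (by rw [heq])
    have hx : σ' s ∈ S.image σ := by rw [himg, ← himg']; exact Finset.mem_image_of_mem _ hs
    obtain ⟨x, hxS, hx⟩ := Finset.mem_image.1 hx
    have hxs : x ≠ s := by rintro rfl; exact hss hx.symm
    refine hxs (hinj hxS hs ?_)
    simp [hh, hxs, hτdef, hτdef', hx]
  have hsub : S.image h ⊂ S := (Finset.image_subset_iff.2 hmem).ssubset_of_ne hnot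
  obtain ⟨S₁, hS₁, hS₁ne, hS₁h⟩ := exists_image_eq_self h (S.image h)
    ⟨h s, Finset.mem_image_of_mem h hs⟩
    (fun x hx => Finset.mem_image_of_mem h (hsub.1 hx))
  have hS₁S : S₁ ⊂ S := hS₁.trans_ssubset hsub
  have hgood : ∀ S' ⊂ S, S'.Nonempty → ∀ f : V → V, S'.image f = S' →
      (∀ i ∈ S', f i = τ i ∨ f i = τ' i) → Good (ind S') (ind (S'.image σ₂)) := by
    intro S' hS' hne f hf hEf
    have him : S'.image (fun x => σ₂ (f x)) = S'.image σ₂ := by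
      conv_rhs => rw [← hf, Finset.image_image]
      rfl
    obtain ⟨ρ, hρ⟩ := exists_perm_eqOn (fun x => σ₂ (f x)) S' (S'.image σ₂) him
      (Finset.card_image_of_injective _ σ₂.injective)
    refine ih S' hS' hne ρ ((Finset.image_congr fun i hi => hρ i hi).trans him) fun i hi => ?_
    rw [hρ i hi]
    rcases hEf i hi with he | he <;> rw [he]
    · simpa [hτdef] using hE i (hS'.1 hi)
    · simpa [hτdef'] using hE' i (hS'.1 hi)
  -- The truncated subtraction is exact: every edge of h is an edge of τ or of τ'. What remains is
  -- balanced, so it decomposes into permuted subsets.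
  set Q : V → V → ℕ := fun i j =>
    (if i ∈ S ∧ τ i = j then 1 else 0) + (if i ∈ S ∧ τ' i = j then 1 else 0) -
      (if i ∈ S₁ ∧ h i = j then 1 else 0) with hQ
  have hQadd : ∀ i j, Q i j + (if i ∈ S₁ ∧ h i = j then 1 else 0) =
      (if i ∈ S ∧ τ i = j then 1 else 0) + (if i ∈ S ∧ τ' i = j then 1 else 0) := by
    intro i j
    refine Nat.sub_add_cancel ?_
    by_cases hi : i ∈ S₁ ∧ h i = j
    · rw [if_pos hi]
      obtain ⟨hi, rfl⟩ := hi
      have hiS := hS₁S.1 hi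
      rcases hcases i with he | he
      · rw [if_pos ⟨hiS, he.symm⟩]; omega
      · rw [if_pos (c := i ∈ S ∧ τ' i = h i) ⟨hiS, he.symm⟩]; omega
    · rw [if_neg hi]; exact Nat.zero_le _
  have hrow : ∀ i, ∑ j, Q i j + (if i ∈ S₁ then 1 else 0) = 2 * if i ∈ S then 1 else 0 := by
    intro i
    rw [← sum_graph_row S₁ h i, ← Finset.sum_add_distrib,
      Finset.sum_congr rfl fun j _ => hQadd i j, Finset.sum_add_distrib, sum_graph_row,
      sum_graph_row, two_mul]
  have hcol : ∀ j, ∑ i, Q i j + (if j ∈ S₁ then 1 else 0) = 2 * if j ∈ S then 1 else 0 := by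
    intro j
    rw [← sum_graph_col hS₁h j, ← Finset.sum_add_distrib,
      Finset.sum_congr rfl fun i _ => hQadd i j, Finset.sum_add_distrib, sum_graph_col hτ,
      sum_graph_col hτ', two_mul]
  obtain ⟨L, hL, hLsum⟩ := exists_list_of_balanced _ Q rfl fun i => by
    have := hrow i
    have := hcol i
    omega
  obtain ⟨k, φ, hφ, hφpos, hsum⟩ := sum_list_ind_decompose hzero hadd S σ₂ L fun S' hS' => by
    obtain ⟨hne, ρ, hρ, hQρ⟩ := hL S' hS'
    have hor : ∀ i ∈ S', i ∈ S ∧ (ρ i = τ i ∨ ρ i = τ' i) := by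
      intro i hi
      have hp := hQρ i hi
      have hQle : Q i (ρ i) ≤ _ := Nat.sub_le _ _
      by_cases h1 : i ∈ S ∧ τ i = ρ i
      · exact ⟨h1.1, Or.inl h1.2.symm⟩
      by_cases h2 : i ∈ S ∧ τ' i = ρ i
      · exact ⟨h2.1, Or.inr h2.2.symm⟩
      rw [if_neg h1, if_neg h2] at hQle
      omega
    by_cases heq : S' = S
    · exact Or.inl heq
    · exact Or.inr (hgood S' (Finset.ssubset_iff_subset_ne.2 ⟨fun i hi => (hor i hi).1, heq⟩) hne
        ρ hρ fun i hi => (hor i hi).2)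
  have htot : ∀ x, (k : ℝ) * ind S x + φ x + ind S₁ x = 2 * ind S x := by
    intro x
    rw [← hsum x, hLsum x]
    have := hrow x
    unfold ind
    exact_mod_cast this
  -- A point of S₁ is covered twice in total and once by S₁, so the rest covers it only once.
  have hk : (k : ℝ) ≤ 1 := by
    obtain ⟨x, hx⟩ := hS₁ne
    have := htot x
    have h1 := hφpos x
    simp only [ind, hx, hS₁S.1 hx, if_true] at this
    linarith
  have hfin := hsmul (1 / (2 - k)) _ _ (by apply div_nonneg <;> linarith)
    (hadd _ _ _ _ (hgood S₁ hS₁S hS₁ne h hS₁h fun i _ => hcases i) hφ)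
  have hS : ∀ x, (1 / (2 - k)) * (ind S₁ x + φ x) = ind S x := by
    intro x
    have h2 : (2 : ℝ) - k ≠ 0 := by linarith
    field_simp
    linarith [htot x]
  convert hfin using 1
  · ext x; simp [← hS x]
  · ext x; simp [ind_image, ← hS]

/-- A property of pairs of functions that is closed under nonnegative combinations and holds for
the pairs of sets that are matched uniquely in both of two relations holds for all the pairs of
sets that are matched in both of them. -/
theorem good_of_matchings {Good : (V → ℝ) → (V → ℝ) → Prop} (hzero : Good 0 0)
    (hadd : ∀ f g f' g', Good f g → Good f' g' → Good (f + f') (g + g'))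
    (hsmul : ∀ (c : ℝ) f g, 0 ≤ c → Good f g → Good (c • f) (c • g))
    {E₁ E₂ : V → V → Prop}
    (hunique : ∀ (S : Finset V) (σ₁ σ₂ : Equiv.Perm V), S.image σ₁ = S.image σ₂ →
      (∀ i ∈ S, E₁ i (σ₁ i)) → (∀ i ∈ S, E₂ i (σ₂ i)) →
      IsUniqueMatching E₁ S σ₁ → IsUniqueMatching E₂ S σ₂ → Good (ind S) (ind (S.image σ₂)))
    (S : Finset V) : ∀ σ₁ σ₂ : Equiv.Perm V, S.image σ₁ = S.image σ₂ →
      (∀ i ∈ S, E₁ i (σ₁ i)) → (∀ i ∈ S, E₂ i (σ₂ i)) → Good (ind S) (ind (S.image σ₂)) := by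
  induction S using Finset.strongInduction with
  | H S ih =>
    intro σ₁ σ₂ himg hE₁ hE₂
    by_cases h1 : IsUniqueMatching E₁ S σ₁
    · by_cases h2 : IsUniqueMatching E₂ S σ₂
      · exact hunique S σ₁ σ₂ himg hE₁ hE₂ h1 h2
      · unfold IsUniqueMatching at h2
        push Not at h2
        obtain ⟨σ', himg', hE', hne⟩ := h2
        rw [← himg]
        refine good_of_two_matchings hzero hadd hsmul himg.symm (himg'.trans himg.symm) hE₂ hE'
          hne fun S' hS' _ ρ hρ hEρ => ?_
        have := ih S' hS' σ₁ ρ hρ.symm (fun i hi => hE₁ i (hS'.1 hi)) hEρ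
        rwa [hρ] at this
    · unfold IsUniqueMatching at h1
      push Not at h1
      obtain ⟨σ', himg', hE', hne⟩ := h1
      exact good_of_two_matchings hzero hadd hsmul himg (himg'.trans himg) hE₁ hE' hne
        fun S' hS' _ ρ hρ hEρ => ih S' hS' ρ σ₂ hρ hEρ (fun i hi => hE₂ i (hS'.1 hi))

end Matchings

/-! ### Single and simultaneous exchanges in one matroid -/

section MatroidExchange

variable {V : Type*} [DecidableEq V]

lemma card_le_card_of_subset_closure {M : Matroid V} {I J : Finset V}
    (hI : M.Indep (I : Set V)) (hIJ : (I : Set V) ⊆ M.closure (J : Set V)) :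
    I.card ≤ J.card := by
  have h := (hI.encard_le_eRk_of_subset hIJ).trans
    ((M.eRk_closure_eq _).le.trans (M.eRk_le_encard _))
  simpa only [Set.encard_coe_eq_coe_finsetCard, Nat.cast_le] using h

/-- Inside an independent set, closure commutes with intersection; equivalently, elements outside
the fundamental circuit of a can be deleted all at once. -/
lemma mem_closure_sdiff {M : Matroid V} {X : Finset V} (hX : M.Indep (X : Set V)) {a : V}
    (ha : a ∈ M.closure (X : Set V)) (J : Finset V)
    (hJ : ∀ j ∈ J, a ∈ M.closure ((X \ {j} : Finset V) : Set V)) :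
    a ∈ M.closure ((X \ J : Finset V) : Set V) := by
  induction J using Finset.induction_on with
  | empty => simpa using ha
  | insert j J _ ih =>
    have h1 := hJ j (Finset.mem_insert_self j J)
    have h2 := ih fun k hk => hJ k (Finset.mem_insert_of_mem hk)
    have hind : M.Indep (((X \ {j} : Finset V) : Set V) ∪ ((X \ J : Finset V) : Set V)) :=
      hX.subset (by
        rw [Set.union_subset_iff]
        exact ⟨by exact_mod_cast Finset.sdiff_subset, by exact_mod_cast Finset.sdiff_subset⟩)
    have h3 : a ∈ M.closure (((X \ {j} : Finset V) : Set V) ∩ ((X \ J : Finset V) : Set V)) := by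
      rw [hind.closure_inter_eq_inter_closure]
      exact ⟨h1, h2⟩
    refine M.closure_subset_closure ?_ h3
    intro x hx
    simp only [Finset.coe_sdiff, Set.mem_inter_iff, Set.mem_sdiff, Finset.mem_coe,
      Finset.mem_singleton] at hx ⊢
    simp only [Finset.mem_insert]
    tauto

/-- Exchange in `X` the elements of `K` in `Y` for the elements of `R` outside `Y`. -/
def swapSet (X Y K R : Finset V) : Finset V := (X \ (R \ Y)) ∪ (K ∩ (Y \ X))

lemma mem_swapSet {X Y K R : Finset V} {x : V} :
    x ∈ swapSet X Y K R ↔ x ∈ X ∧ (x ∈ R → x ∈ Y) ∨ x ∈ K ∧ x ∈ Y ∧ x ∉ X := by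
  simp only [swapSet, Finset.mem_union, Finset.mem_sdiff, Finset.mem_inter]
  tauto

/-- Single exchanges that keep `X` independent. -/
def CanExchange (M : Matroid V) (X Y : Finset V) (i j : V) : Prop :=
  M.Indep (swapSet X Y {i} {j} : Set V)

/-- Exchanges with i outside Y \ X add nothing and are always possible, so a failure carries
dependence information. If moreover j is not in X \ Y, nothing is removed and i is simply spanned by
X. -/
lemma of_not_canExchange {M : Matroid V} (hE : M.E = Set.univ) {X Y : Finset V}
    (hX : M.Indep (X : Set V)) {i j : V} (h : ¬ CanExchange M X Y i j) :
    i ∈ Y ∧ i ∉ X ∧ i ∈ M.closure ((X \ ({j} \ Y) : Finset V) : Set V) := by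
  have hi : i ∈ Y ∧ i ∉ X := by
    by_contra hcon
    refine h (hX.subset ?_)
    intro x hx
    rw [Finset.mem_coe, mem_swapSet, Finset.mem_singleton, Finset.mem_singleton] at hx
    rcases hx with hx | ⟨rfl, hx⟩
    · exact hx.1
    · exact absurd hx hcon
  refine ⟨hi.1, hi.2, ?_⟩
  have hind : M.Indep ((X \ ({j} \ Y) : Finset V) : Set V) :=
    hX.subset (by exact_mod_cast Finset.sdiff_subset)
  rw [hind.mem_closure_iff_of_notMem (by simp [hi.2]), ← Matroid.not_indep_iff (by simp [hE])]
  refine fun hcon => h (hcon.subset ?_)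
  intro x hx
  rw [Finset.mem_coe, mem_swapSet, Finset.mem_singleton, Finset.mem_singleton] at hx
  simp only [Set.mem_insert_iff, Finset.mem_coe, Finset.mem_sdiff, Finset.mem_singleton]
  tauto

/-- Hall's condition follows from rank. Unless some element of K is joined to everything, K lies in
Y \ X and is spanned by X minus the non-neighbours in X \ Y. As K ∪ (X ∩ Y) ⊆ Y is independent,
comparing sizes gives |K| ≤ |N|. The vacuous exchanges pad the matching to a permutation of the
whole ground set. -/
lemma exists_perm_canExchange [Fintype V] {M : Matroid V} (hE : M.E = Set.univ) {X Y : Finset V}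
    (hX : M.Indep (X : Set V)) (hY : M.Indep (Y : Set V)) :
    ∃ σ : Equiv.Perm V, ∀ i, CanExchange M X Y i (σ i) := by
  classical
  have hall : ∀ K : Finset V,
      K.card ≤ (K.biUnion fun i => Finset.univ.filter fun j => CanExchange M X Y i j).card := by
    intro K
    set N := K.biUnion fun i => Finset.univ.filter fun j => CanExchange M X Y i j with hN
    by_cases hfull : ∃ i ∈ K, ∀ j, CanExchange M X Y i j
    · obtain ⟨i, hi, hij⟩ := hfull
      refine Finset.card_le_card fun x _ => ?_
      rw [hN, Finset.mem_biUnion]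
      exact ⟨i, hi, by simpa using hij x⟩
    push Not at hfull
    have hKsub : ∀ i ∈ K, i ∈ Y ∧ i ∉ X := by
      intro i hi
      obtain ⟨j, hj⟩ := hfull i hi
      have := of_not_canExchange hE hX hj
      exact ⟨this.1, this.2.1⟩
    have hcl : ((K ∪ (X ∩ Y) : Finset V) : Set V) ⊆
        M.closure ((X \ ((X \ Y) \ N) : Finset V) : Set V) := by
      intro i hi
      rw [Finset.mem_coe, Finset.mem_union] at hi
      rcases hi with hi | hi
      · obtain ⟨j, hj⟩ := hfull i hi
        refine mem_closure_sdiff hX ?_ _ fun k hk => ?_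
        · exact M.closure_subset_closure (by exact_mod_cast Finset.sdiff_subset)
            (of_not_canExchange hE hX hj).2.2
        · simp only [Finset.mem_sdiff] at hk
          have hnot : ¬ CanExchange M X Y i k := by
            intro hcon
            exact hk.2 (Finset.mem_biUnion.2 ⟨i, hi, by simpa using hcon⟩)
          have := (of_not_canExchange hE hX hnot).2.2
          rwa [Finset.sdiff_eq_self_of_disjoint (s := {k}) (by simpa using hk.1.2)] at this
      · refine M.mem_closure_of_mem' ?_ (by simp [hE])
        simp only [Finset.mem_inter] at hi
        simp [hi]
    have hind : M.Indep ((K ∪ (X ∩ Y) : Finset V) : Set V) := by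
      refine hY.subset ?_
      intro x hx
      rw [Finset.mem_coe, Finset.mem_union, Finset.mem_inter] at hx
      rcases hx with hx | hx
      · exact (hKsub x hx).1
      · exact hx.2
    have h1 := card_le_card_of_subset_closure hind hcl
    rw [Finset.card_union_of_disjoint (Finset.disjoint_left.2 fun x hx hx' =>
      (hKsub x hx).2 (Finset.mem_inter.1 hx').1)] at h1
    have h2 : (X \ ((X \ Y) \ N)).card ≤ (X ∩ Y).card + N.card := by
      refine (Finset.card_le_card (t := (X ∩ Y) ∪ N) fun x hx => ?_).trans
        (Finset.card_union_le _ _)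
      simp only [Finset.mem_sdiff, Finset.mem_union, Finset.mem_inter] at hx ⊢
      tauto
    omega
  obtain ⟨f, hf, hft⟩ := (Finset.all_card_le_biUnion_card_iff_exists_injective _).1 hall
  exact ⟨Equiv.ofBijective f (Finite.injective_iff_bijective.1 hf), fun i => by
    simpa using hft i⟩

/-- A unique perfect matching of single exchanges can be performed simultaneously. -/
lemma indep_swapSet_of_isUniqueMatching [Fintype V] {M : Matroid V} (hE : M.E = Set.univ)
    {X Y : Finset V} (hX : M.Indep (X : Set V)) {S : Finset V} {σ : Equiv.Perm V}
    (hσ : ∀ i ∈ S, CanExchange M X Y i (σ i)) (huniq : IsUniqueMatching (CanExchange M X Y) S σ)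
    (K : Finset V) (hK : K ⊆ S) : M.Indep (swapSet X Y K (K.image σ) : Set V) := by
  induction K using Finset.strongInduction with
  | H K ih =>
  rcases K.eq_empty_or_nonempty with rfl | hne
  · simpa [swapSet] using hX
  -- Exchange the source i last: the rest K' is handled by induction, and i has no edge to the
  -- partners of K', so it is spanned by X without their removable elements.
  obtain ⟨i, hiK, hsrc⟩ := huniq.exists_source hσ hK hne
  have hiE := hσ i (hK hiK)
  rcases (K.erase i).eq_empty_or_nonempty with hemp | hne'
  · have : K = {i} := by
      rw [← Finset.insert_erase hiK, hemp]; rfl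
    subst this
    simpa [CanExchange] using hiE
  have hW := ih (K.erase i) (Finset.erase_ssubset hiK) ((Finset.erase_subset _ _).trans hK)
  set K' := K.erase i with hK'
  set W := swapSet X Y K' (K'.image σ) with hWdef
  have hnot : ∀ j ∈ K', ¬ CanExchange M X Y i (σ j) := fun j hj =>
    hsrc j (Finset.mem_of_mem_erase hj) (Finset.ne_of_mem_erase hj)
  obtain ⟨j₀, hj₀⟩ := hne'
  obtain ⟨hiY, hiX, hicl⟩ := of_not_canExchange hE hX (hnot j₀ hj₀)
  have hiclX : i ∈ M.closure (X : Set V) :=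
    M.closure_subset_closure (by exact_mod_cast Finset.sdiff_subset) hicl
  have hicl' : i ∈ M.closure ((X \ (K'.image σ \ Y) : Finset V) : Set V) := by
    refine mem_closure_sdiff hX hiclX _ fun r hr => ?_
    rw [Finset.mem_sdiff, Finset.mem_image] at hr
    obtain ⟨⟨j, hj, rfl⟩, hrY⟩ := hr
    have := (of_not_canExchange hE hX (hnot j hj)).2.2
    rwa [Finset.sdiff_eq_self_of_disjoint (s := {σ j}) (by simpa using hrY)] at this
  have hinotcl : i ∉ M.closure ((X \ ({σ i} \ Y) : Finset V) : Set V) := by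
    have hind : M.Indep ((X \ ({σ i} \ Y) : Finset V) : Set V) :=
      hX.subset (by exact_mod_cast Finset.sdiff_subset)
    rw [hind.notMem_closure_iff_of_notMem (by simp [hiX]) (by simp [hE])]
    refine hiE.subset ?_
    intro x hx
    rw [Finset.mem_coe, mem_swapSet, Finset.mem_singleton, Finset.mem_singleton]
    simp only [Set.mem_insert_iff, Finset.mem_coe, Finset.mem_sdiff, Finset.mem_singleton] at hx
    rcases hx with rfl | hx
    · exact Or.inr ⟨rfl, hiY, hiX⟩
    · tauto
  have hb : σ i ∈ X ∧ σ i ∉ Y := by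
    by_contra hcon
    refine hinotcl (M.closure_subset_closure ?_ hiclX)
    intro x hx
    simp only [Finset.coe_sdiff, Set.mem_sdiff, Finset.mem_coe, Finset.mem_singleton]
    refine ⟨hx, ?_⟩
    rintro ⟨rfl, hy⟩
    exact hcon ⟨hx, hy⟩
  have hWb : M.Indep ((W \ {σ i} : Finset V) : Set V) :=
    hW.subset (by exact_mod_cast Finset.sdiff_subset)
  have hiW : i ∉ W := by
    rw [hWdef, mem_swapSet]
    simp [hiX, hK']
  have hinot : i ∉ M.closure ((W \ {σ i} : Finset V) : Set V) := by
    -- Let Z be X without the removable partners of K'; both Z and W \ {σ i} lie in the independent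
    -- set W. If i were spanned by both, it would be spanned by their intersection, which avoids σ i
    -- and lies in X. This contradicts the single exchange of i for σ i.
    intro hcon
    have hZW : ((X \ (K'.image σ \ Y) : Finset V) : Set V) ⊆ W := by
      exact_mod_cast (Finset.subset_union_left : _ ⊆ W)
    have hind : M.Indep (((X \ (K'.image σ \ Y) : Finset V) : Set V) ∪
        ((W \ {σ i} : Finset V) : Set V)) :=
      hW.subset (Set.union_subset hZW (by exact_mod_cast Finset.sdiff_subset))
    have h3 := hind.closure_inter_eq_inter_closure.symm.subset ⟨hicl', hcon⟩
    refine hinotcl (M.closure_subset_closure ?_ h3)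
    intro x hx
    simp only [Finset.coe_sdiff, Set.mem_inter_iff, Set.mem_sdiff, Finset.mem_coe,
      Finset.mem_singleton] at hx ⊢
    tauto
  rw [hWb.notMem_closure_iff_of_notMem (by simp [hiW]) (by simp [hE])] at hinot
  refine hinot.subset ?_
  intro x hx
  rw [Finset.mem_coe, mem_swapSet] at hx
  simp only [Set.mem_insert_iff, Finset.mem_coe, Finset.mem_sdiff, Finset.mem_singleton, hWdef,
    mem_swapSet]
  by_cases hxi : x = i
  · exact Or.inl hxi
  · refine Or.inr ?_
    have hmem : x ∈ K → x ∈ K' := fun h => Finset.mem_erase.2 ⟨hxi, h⟩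
    have himg : x ∈ K'.image σ → x ∈ K.image σ :=
      fun h => Finset.image_subset_image (Finset.erase_subset _ _) h
    have hσi : σ i ∈ K.image σ := Finset.mem_image_of_mem σ hiK
    rcases hx with hx | hx
    · exact ⟨Or.inl ⟨hx.1, fun h => hx.2 (himg h)⟩, fun h => hb.2 (by
        rw [← h]; exact hx.2 (h ▸ hσi))⟩
    · exact ⟨Or.inr ⟨hmem hx.1, hx.2⟩, fun h => hx.2.2 (h ▸ hb.1)⟩

end MatroidExchange

/-! ### Weighted exchange families for two matroids -/

section Families

variable {V : Type} [DecidableEq V]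

/-- There is a weighted family of exchanges `(A, B)` with the property `feas`, in which the sets
`A` cover the elements `x` with total weight `f x` and the sets `B` with at most `g x`. -/
def HasExchangeFamily (feas : Finset V → Finset V → Prop) (f g : V → ℝ) : Prop :=
  ∃ (ι : Type) (_ : Fintype ι) (w : ι → ℝ) (A B : ι → Finset V),
    (∀ i, 0 ≤ w i) ∧ (∀ i, feas (A i) (B i)) ∧
    (∀ x, ∑ i, (if x ∈ A i then w i else 0) = f x) ∧
    ∀ x, ∑ i, (if x ∈ B i then w i else 0) ≤ g x

lemma hasExchangeFamily_zero (feas : Finset V → Finset V → Prop) :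
    HasExchangeFamily feas 0 0 :=
  ⟨Empty, inferInstance, Empty.elim, Empty.elim, Empty.elim, by simp⟩

lemma HasExchangeFamily.add {feas : Finset V → Finset V → Prop} {f g f' g' : V → ℝ}
    (h : HasExchangeFamily feas f g) (h' : HasExchangeFamily feas f' g') :
    HasExchangeFamily feas (f + f') (g + g') := by
  obtain ⟨ι, _, w, A, B, hw, hfeas, hA, hB⟩ := h
  obtain ⟨ι', _, w', A', B', hw', hfeas', hA', hB'⟩ := h'
  refine ⟨ι ⊕ ι', inferInstance, Sum.elim w w', Sum.elim A A', Sum.elim B B', ?_, ?_, ?_, ?_⟩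
  · rintro (i | i)
    exacts [hw i, hw' i]
  · rintro (i | i)
    exacts [hfeas i, hfeas' i]
  · intro x
    rw [Fintype.sum_sum_type]
    exact congrArg₂ (· + ·) (hA x) (hA' x)
  · intro x
    rw [Fintype.sum_sum_type]
    exact add_le_add (hB x) (hB' x)

lemma HasExchangeFamily.smul {feas : Finset V → Finset V → Prop} {f g : V → ℝ} {c : ℝ}
    (hc : 0 ≤ c) (h : HasExchangeFamily feas f g) :
    HasExchangeFamily feas (c • f) (c • g) := by
  obtain ⟨ι, _, w, A, B, hw, hfeas, hA, hB⟩ := h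
  refine ⟨ι, inferInstance, fun i => c * w i, A, B, fun i => mul_nonneg hc (hw i), hfeas, ?_, ?_⟩
  · intro x
    simp only [Pi.smul_apply, smul_eq_mul, ← hA x, Finset.mul_sum, mul_ite, mul_zero]
  · intro x
    have := mul_le_mul_of_nonneg_left (hB x) hc
    simpa only [Pi.smul_apply, smul_eq_mul, Finset.mul_sum, mul_ite, mul_zero] using this

/-- Adding `A ⊆ Y` to `X` and removing `B` keeps `X` independent in two matroids. -/
def IsPairExchange (M₁ M₂ : Matroid V) (X Y : Finset V) (q : ℕ) (A B : Finset V) : Prop :=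
  A ⊆ Y \ X ∧ B ⊆ X \ Y ∧ A.card ≤ q ∧ B.card ≤ 2 * q ∧
    M₁.Indep ((X \ B ∪ A : Finset V) : Set V) ∧ M₂.Indep ((X \ B ∪ A : Finset V) : Set V)

variable [Fintype V]

/-- Index the exchanges by the windows W of τ = σ₂⁻¹σ₁ inside S, and remove both σ₁ W and σ₂ W, so
that independence holds in both matroids. Since σ₁ x = σ₂ (τ x), the element σ₁ x is removed exactly
when W meets {x, τ x}, which has weight at most q + 1. -/
lemma exchangeFamily_of_unique {M₁ M₂ : Matroid V} (h₁ : M₁.E = Set.univ) (h₂ : M₂.E = Set.univ)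
    {X Y : Finset V} (hX₁ : M₁.Indep (X : Set V)) (hX₂ : M₂.Indep (X : Set V)) {q : ℕ}
    (hq : 1 ≤ q) {S : Finset V} {σ₁ σ₂ : Equiv.Perm V} (himg : S.image σ₁ = S.image σ₂)
    (hE₁ : ∀ i ∈ S, CanExchange M₁ X Y i (σ₁ i)) (hE₂ : ∀ i ∈ S, CanExchange M₂ X Y i (σ₂ i))
    (hu₁ : IsUniqueMatching (CanExchange M₁ X Y) S σ₁)
    (hu₂ : IsUniqueMatching (CanExchange M₂ X Y) S σ₂) :
    HasExchangeFamily (IsPairExchange M₁ M₂ X Y q)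
      (fun x => if x ∈ Y \ X then q * ind S x else 0)
      (fun x => if x ∈ X \ Y then (q + 1) * ind (S.image σ₂) x else 0) := by
  set τ : Equiv.Perm V := σ₂⁻¹ * σ₁ with hτ
  have hστ : ∀ x, σ₂ (τ x) = σ₁ x := by intro x; simp [hτ]
  have hτS : ∀ x ∈ S, τ x ∈ S := by
    intro x hx
    have : σ₁ x ∈ S.image σ₂ := himg ▸ Finset.mem_image_of_mem _ hx
    obtain ⟨y, hy, hyx⟩ := Finset.mem_image.1 this
    rw [← hστ] at hyx
    rwa [← σ₂.injective hyx]
  have hτS' : ∀ x, τ x ∈ S → x ∈ S := by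
    intro x hx
    have : σ₁ x ∈ S.image σ₁ := by
      rw [himg, ← hστ]; exact Finset.mem_image_of_mem _ hx
    simpa using this
  have hτc : ∀ x ∈ Sᶜ, τ x ∈ Sᶜ := by
    intro x hx
    rw [Finset.mem_compl] at hx ⊢
    exact fun h => hx (hτS' x h)
  have hS : ∀ {v x}, x ∈ orbitWindow τ q v → (v ∈ S ↔ x ∈ S) := by
    intro v x hx
    by_cases hv : v ∈ S
    · simp [hv, orbitWindow_subset hτS q hv hx]
    · have := orbitWindow_subset hτc q (Finset.mem_compl.2 hv) hx
      simp [hv, Finset.mem_compl.1 this]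
  set W : V → Finset V := fun v => if v ∈ S then orbitWindow τ q v else ∅ with hW
  have hWmem : ∀ v x, x ∈ W v ↔ x ∈ S ∧ x ∈ orbitWindow τ q v := by
    intro v x
    simp only [hW]
    constructor
    · intro h
      split_ifs at h with hv
      · exact ⟨(hS h).1 hv, h⟩
      · simp at h
    · rintro ⟨hx, h⟩
      rwa [if_pos ((hS h).2 hx)]
  have hWS : ∀ v, W v ⊆ S := fun v x hx => ((hWmem v x).1 hx).1
  have hWcard : ∀ v, (W v).card ≤ q := fun v =>
    (Finset.card_le_card fun x hx => ((hWmem v x).1 hx).2).trans (card_orbitWindow_le τ q v)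
  refine ⟨V, inferInstance, windowWeight τ q, fun v => W v ∩ (Y \ X),
    fun v => ((W v).image σ₁ ∪ (W v).image σ₂) ∩ (X \ Y), windowWeight_nonneg τ q,
    fun v => ⟨Finset.inter_subset_right, Finset.inter_subset_right, ?_, ?_, ?_, ?_⟩, ?_, ?_⟩
  · exact (Finset.card_le_card Finset.inter_subset_left).trans (hWcard v)
  · refine (Finset.card_le_card Finset.inter_subset_left).trans
      ((Finset.card_union_le _ _).trans ?_)
    have h1 := (Finset.card_image_le (s := W v) (f := σ₁)).trans (hWcard v)
    have h2 := (Finset.card_image_le (s := W v) (f := σ₂)).trans (hWcard v)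
    omega
  · refine (indep_swapSet_of_isUniqueMatching h₁ hX₁ hE₁ hu₁ (W v) (hWS v)).subset ?_
    intro x hx
    simp only [Finset.mem_coe, mem_swapSet, Finset.mem_union, Finset.mem_sdiff,
      Finset.mem_inter] at hx ⊢
    tauto
  · refine (indep_swapSet_of_isUniqueMatching h₂ hX₂ hE₂ hu₂ (W v) (hWS v)).subset ?_
    intro x hx
    simp only [Finset.mem_coe, mem_swapSet, Finset.mem_union, Finset.mem_sdiff,
      Finset.mem_inter] at hx ⊢
    tauto
  · intro x
    beta_reduce
    by_cases hx : x ∈ Y \ X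
    · rw [if_pos hx]
      by_cases hxS : x ∈ S
      · simp only [Finset.mem_inter, hx, and_true, hWmem, hxS, true_and, ind, if_true, mul_one]
        exact sum_windowWeight hq τ x
      · simp [hWmem, hxS, ind]
    · rw [if_neg hx]
      simp [Finset.mem_inter, hx]
  · intro r
    beta_reduce
    by_cases hr : r ∈ X \ Y
    · rw [if_pos hr]
      obtain ⟨x, rfl⟩ := σ₁.surjective r
      have hmem : ∀ v, σ₁ x ∈ ((W v).image σ₁ ∪ (W v).image σ₂) ∩ (X \ Y) ↔
          x ∈ S ∧ (x ∈ orbitWindow τ q v ∨ τ x ∈ orbitWindow τ q v) := by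
        intro v
        rw [Finset.mem_inter, and_iff_left hr, Finset.mem_union]
        have e1 : σ₁ x ∈ (W v).image σ₁ ↔ x ∈ W v := by simp
        have e2 : σ₁ x ∈ (W v).image σ₂ ↔ τ x ∈ W v := by
          rw [← hστ]; simp
        rw [e1, e2, hWmem, hWmem]
        have : τ x ∈ S ↔ x ∈ S := ⟨hτS' x, hτS x⟩
        tauto
      simp only [hmem]
      rw [← himg, ind_image, Equiv.symm_apply_apply]
      by_cases hxS : x ∈ S
      · simp only [hxS, true_and, ind, if_true, mul_one]
        exact sum_windowWeight_consecutive hq τ x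
      · simp [hxS, ind]
    · rw [if_neg hr]
      simp [Finset.mem_inter, hr]

/-- The exchange property of the intersection of two matroids. -/
theorem exchangeFamily_two_matroids {M₁ M₂ : Matroid V} (h₁ : M₁.E = Set.univ)
    (h₂ : M₂.E = Set.univ) {X Y : Finset V} (hX₁ : M₁.Indep (X : Set V))
    (hX₂ : M₂.Indep (X : Set V)) (hY₁ : M₁.Indep (Y : Set V)) (hY₂ : M₂.Indep (Y : Set V))
    {q : ℕ} (hq : 1 ≤ q) :
    HasExchangeFamily (IsPairExchange M₁ M₂ X Y q)
      (fun x => if x ∈ Y \ X then (q : ℝ) else 0)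
      (fun x => if x ∈ X \ Y then (q : ℝ) + 1 else 0) := by
  obtain ⟨σ₁, hσ₁⟩ := exists_perm_canExchange h₁ hX₁ hY₁
  obtain ⟨σ₂, hσ₂⟩ := exists_perm_canExchange h₂ hX₂ hY₂
  have himg : ∀ σ : Equiv.Perm V, Finset.univ.image σ = Finset.univ := fun σ =>
    Finset.image_univ_of_surjective σ.surjective
  -- The scaled property is closed under nonnegative combinations, so it passes from unique
  -- matchings to the arbitrary permutations σ₁ and σ₂ of the ground set.
  have key := good_of_matchings
    (Good := fun f g => HasExchangeFamily (IsPairExchange M₁ M₂ X Y q)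
      (fun x => if x ∈ Y \ X then q * f x else 0)
      (fun x => if x ∈ X \ Y then (q + 1) * g x else 0))
    (E₁ := CanExchange M₁ X Y) (E₂ := CanExchange M₂ X Y)
    (by
      convert hasExchangeFamily_zero (IsPairExchange M₁ M₂ X Y q) using 1 <;> ext <;> simp)
    (by
      intro f g f' g' h h'
      convert h.add h' using 1
      · ext x; simp only [Pi.add_apply]; split_ifs <;> ring
      · ext x; simp only [Pi.add_apply]; split_ifs <;> ring)
    (by
      intro c f g hc h
      convert h.smul hc using 1
      · ext x; simp only [Pi.smul_apply, smul_eq_mul]; split_ifs <;> ring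
      · ext x; simp only [Pi.smul_apply, smul_eq_mul]; split_ifs <;> ring)
    (fun S τ₁ τ₂ him hE₁ hE₂ hu₁ hu₂ =>
      exchangeFamily_of_unique h₁ h₂ hX₁ hX₂ hq him hE₁ hE₂ hu₁ hu₂)
    Finset.univ σ₁ σ₂ (by rw [himg, himg]) (fun i _ => hσ₁ i) (fun i _ => hσ₂ i)
  simpa [himg, ind] using key

end Families

/-! ### Greedy weighted removals in one matroid -/

section MatroidRemoval

variable {V : Type*} [DecidableEq V]

lemma card_union_three {R P A : Finset V} (h₁ : Disjoint R P) (h₂ : Disjoint R A)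
    (h₃ : Disjoint P A) : (R ∪ P ∪ A).card = R.card + P.card + A.card := by
  rw [Finset.card_union_of_disjoint (Finset.disjoint_union_left.2 ⟨h₂, h₃⟩),
    Finset.card_union_of_disjoint h₁]

lemma sum_weight_card {ι : Type*} [Fintype ι] (w : ι → ℝ) (A : ι → Finset V) (D : Finset V) :
    ∑ i, w i * ((A i ∩ D).card : ℝ) = ∑ x ∈ D, ∑ i, (if x ∈ A i then w i else 0) := by
  rw [Finset.sum_comm]
  refine Finset.sum_congr rfl fun i _ => ?_
  rw [Finset.sum_ite_mem, Finset.sum_const, nsmul_eq_mul, mul_comm, Finset.inter_comm]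

/-- Extend (X ∩ Y) ∪ P by A' ⊆ Y \ X to a basis of its union with Y \ X. Rank comparison gives |(Y \
X) \ A'| ≤ |P|, because Y is independent, and |B i| ≤ |A i \ A'|. The covering by the sets A i turns
the second bound into q |(Y \ X) \ A'|. -/
lemma sum_weight_card_le {M : Matroid V} (hE : M.E = Set.univ) {X Y : Finset V}
    (hX : M.Indep (X : Set V)) (hY : M.Indep (Y : Set V)) {ι : Type*} [Fintype ι] {w : ι → ℝ}
    (hw : ∀ i, 0 ≤ w i) {A : ι → Finset V} (hA : ∀ i, A i ⊆ Y \ X) {q : ℝ} (hq : 0 ≤ q)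
    (hcov : ∀ x ∈ Y \ X, ∑ i, (if x ∈ A i then w i else 0) = q)
    {P : Finset V} (hP : P ⊆ X \ Y) {B : ι → Finset V} (hBP : ∀ i, B i ⊆ P)
    (hcl : ∀ i, (P : Set V) ⊆ M.closure (((X ∩ Y) ∪ (P \ B i) ∪ A i : Finset V) : Set V)) :
    ∑ i, w i * ((B i).card : ℝ) ≤ q * P.card := by
  classical
  have hRP : Disjoint (X ∩ Y) P := Finset.disjoint_left.2 fun x hx hx' =>
    (Finset.mem_sdiff.1 (hP hx')).2 (Finset.mem_inter.1 hx).2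
  have hRA : ∀ {A : Finset V}, A ⊆ Y \ X → Disjoint (X ∩ Y) A := fun hA =>
    Finset.disjoint_left.2 fun x hx hx' =>
      (Finset.mem_sdiff.1 (hA hx')).2 (Finset.mem_inter.1 hx).1
  have hPA : ∀ {A : Finset V}, A ⊆ Y \ X → Disjoint P A := fun hA =>
    Finset.disjoint_left.2 fun x hx hx' =>
      (Finset.mem_sdiff.1 (hA hx')).2 (Finset.mem_sdiff.1 (hP hx)).1
  have hind : M.Indep (((X ∩ Y) ∪ P : Finset V) : Set V) := by
    refine hX.subset ?_
    exact_mod_cast Finset.union_subset Finset.inter_subset_left (hP.trans Finset.sdiff_subset)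
  obtain ⟨J, hJ, hRJ⟩ := hind.subset_isBasis_of_subset
    (X := (((X ∩ Y) ∪ P ∪ (Y \ X) : Finset V) : Set V))
    (by exact_mod_cast Finset.subset_union_left) (by simp [hE])
  set A' : Finset V := (Y \ X).filter (· ∈ J) with hA'
  have hA'sub : A' ⊆ Y \ X := Finset.filter_subset _ _
  have hJeq : J = (((X ∩ Y) ∪ P ∪ A' : Finset V) : Set V) := by
    ext x
    constructor
    · intro hx
      have := hJ.subset hx
      rw [Finset.mem_coe, Finset.mem_union] at this ⊢
      exact this.imp_right fun h => Finset.mem_filter.2 ⟨h, hx⟩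
    · intro hx
      rw [Finset.mem_coe, Finset.mem_union] at hx
      rcases hx with hx | hx
      · exact hRJ hx
      · exact (Finset.mem_filter.1 hx).2
  have h1 : ((Y \ X) \ A').card ≤ P.card := by
    have hle : ((X ∩ Y) ∪ ∅ ∪ (Y \ X)).card ≤ ((X ∩ Y) ∪ P ∪ A').card := by
      refine card_le_card_of_subset_closure (M := M) (hY.subset ?_) ?_
      · intro x hx
        simp only [Finset.mem_coe, Finset.mem_union, Finset.mem_inter, Finset.mem_sdiff,
          Finset.notMem_empty] at hx ⊢
        tauto
      · rw [← hJeq]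
        refine Set.Subset.trans ?_ hJ.subset_closure
        intro x hx
        simp only [Finset.mem_coe, Finset.mem_union, Finset.notMem_empty] at hx ⊢
        tauto
    rw [card_union_three (Finset.disjoint_empty_right _) (hRA subset_rfl)
      (Finset.disjoint_empty_left _), card_union_three hRP (hRA hA'sub) (hPA hA'sub)] at hle
    rw [Finset.card_sdiff_of_subset hA'sub]
    simp only [Finset.card_empty] at hle
    omega
  have h2 : ∀ i, (B i).card ≤ (A i ∩ ((Y \ X) \ A')).card := by
    intro i
    have hsub : A i ∩ A' ⊆ Y \ X := Finset.inter_subset_left.trans (hA i)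
    have hle : ((X ∩ Y) ∪ P ∪ (A i ∩ A')).card ≤ ((X ∩ Y) ∪ (P \ B i) ∪ A i).card := by
      refine card_le_card_of_subset_closure (M := M) (hJ.indep.subset ?_) ?_
      · rw [hJeq]
        exact_mod_cast Finset.union_subset_union subset_rfl Finset.inter_subset_right
      · intro x hx
        rw [Finset.mem_coe, Finset.mem_union, Finset.mem_union] at hx
        rcases hx with (hx | hx) | hx
        · exact M.mem_closure_of_mem' (by simp [Finset.mem_inter.1 hx]) (by simp [hE])
        · exact hcl i hx
        · exact M.mem_closure_of_mem' (by simp [(Finset.mem_inter.1 hx).1]) (by simp [hE])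
    rw [card_union_three hRP (hRA hsub) (hPA hsub), card_union_three
      (hRP.mono_right Finset.sdiff_subset) (hRA (hA i))
      ((hPA (hA i)).mono_left Finset.sdiff_subset), Finset.card_sdiff_of_subset (hBP i)] at hle
    have hB := Finset.card_le_card (hBP i)
    have hsplit : (A i ∩ ((Y \ X) \ A')).card + (A i ∩ A').card = (A i).card := by
      have : A i ∩ ((Y \ X) \ A') = A i \ A' := by
        ext x
        have := @hA i x
        simp only [Finset.mem_inter, Finset.mem_sdiff] at this ⊢
        tauto
      rw [this, Finset.card_sdiff_add_card_inter]
    omega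
  calc ∑ i, w i * ((B i).card : ℝ) ≤ ∑ i, w i * ((A i ∩ ((Y \ X) \ A')).card : ℝ) :=
        Finset.sum_le_sum fun i _ => mul_le_mul_of_nonneg_left (by exact_mod_cast h2 i) (hw i)
    _ = ∑ x ∈ (Y \ X) \ A', q := by
        rw [sum_weight_card]
        exact Finset.sum_congr rfl fun x hx => hcov x (Finset.mem_sdiff.1 hx).1
    _ ≤ q * P.card := by
        rw [Finset.sum_const, nsmul_eq_mul, mul_comm]
        exact mul_le_mul_of_nonneg_left (by exact_mod_cast h1) hq

/-- Elements of P are offered in order of decreasing cost and kept whenever they are not yet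
spanned, so expensive elements are preferred. The term with γ is the Abel summation invariant: the
unused removal budget on P is still charged at a rate γ not above any cost in P. -/
lemma exists_greedy_removal {M : Matroid V} (hE : M.E = Set.univ) {X Y : Finset V}
    (hX : M.Indep (X : Set V)) (hY : M.Indep (Y : Set V)) {ι : Type*} [Fintype ι] {w : ι → ℝ}
    (hw : ∀ i, 0 ≤ w i) {A : ι → Finset V} (hA : ∀ i, A i ⊆ Y \ X) {q : ℝ} (hq : 0 ≤ q)
    (hcov : ∀ x ∈ Y \ X, ∑ i, (if x ∈ A i then w i else 0) = q) (c : V → ℝ) (P : Finset V) :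
    P ⊆ X \ Y → ∃ B : ι → Finset V, (∀ i, B i ⊆ P) ∧
      (∀ i, M.Indep (((X ∩ Y) ∪ (P \ B i) ∪ A i : Finset V) : Set V)) ∧
      (∀ i, (P : Set V) ⊆ M.closure (((X ∩ Y) ∪ (P \ B i) ∪ A i : Finset V) : Set V)) ∧
      ∀ γ, (∀ x ∈ P, γ ≤ c x) →
        ∑ i, w i * ∑ b ∈ B i, c b + γ * (q * P.card - ∑ i, w i * ((B i).card : ℝ)) ≤
          q * ∑ b ∈ P, c b := by
  classical
  induction P using Finset.induction_on_min_value c with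
  | empty =>
    refine fun _ => ⟨fun _ => ∅, by simp, fun i => hY.subset ?_, by simp, by simp⟩
    intro x hx
    have := @hA i x
    simp only [Finset.mem_coe, Finset.mem_union, Finset.mem_inter, Finset.mem_sdiff,
      Finset.notMem_empty] at hx this
    rw [Finset.mem_coe]
    tauto
  | insert a P haP hmin ih =>
    intro hP
    obtain ⟨B, hBP, hBind, hBcl, hsum⟩ := ih ((Finset.subset_insert a P).trans hP)
    have haB : ∀ i, a ∉ B i := fun i h => haP (hBP i h)
    have haXY := Finset.mem_sdiff.1 (hP (Finset.mem_insert_self a P))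
    set I : ι → Finset V := fun i => (X ∩ Y) ∪ (P \ B i) ∪ A i with hI
    set B' : ι → Finset V := fun i => if a ∈ M.closure (I i : Set V) then insert a (B i) else B i
      with hB'
    have hB'P : ∀ i, B' i ⊆ insert a P := by
      intro i
      simp only [hB']
      split_ifs
      · exact Finset.insert_subset_insert a (hBP i)
      · exact (hBP i).trans (Finset.subset_insert a P)
    have hset : ∀ i, (X ∩ Y) ∪ (insert a P \ B' i) ∪ A i =
        if a ∈ M.closure (I i : Set V) then I i else insert a (I i) := by
      intro i
      simp only [hB', hI]
      split_ifs with h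
      · rw [Finset.insert_sdiff_insert, Finset.sdiff_insert_of_notMem haP]
      · rw [Finset.insert_sdiff_of_notMem _ (haB i), Finset.union_insert, Finset.insert_union]
    have hcl' : ∀ i, ((insert a P : Finset V) : Set V) ⊆
        M.closure (((X ∩ Y) ∪ (insert a P \ B' i) ∪ A i : Finset V) : Set V) := by
      intro i
      rw [hset, Finset.coe_insert, Set.insert_subset_iff]
      split_ifs with h
      · exact ⟨h, hBcl i⟩
      · refine ⟨M.mem_closure_of_mem' (by simp) (by simp [hE]), (hBcl i).trans ?_⟩
        exact M.closure_subset_closure (by exact_mod_cast Finset.subset_insert a (I i))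
    refine ⟨B', hB'P, fun i => ?_, hcl', fun γ hγ => ?_⟩
    · rw [hset]
      split_ifs with h
      · exact hBind i
      · rw [Finset.coe_insert]
        exact ((hBind i).notMem_closure_iff (by simp [hE])).1 h |>.1
    · have hslack := sum_weight_card_le hE hX hY hw hA hq hcov hP hB'P hcl'
      set δ : ι → ℝ := fun i => if a ∈ M.closure (I i : Set V) then 1 else 0 with hδ
      have hcard : ∀ i, ((B' i).card : ℝ) = (B i).card + δ i := by
        intro i
        simp only [hB', hδ]
        split_ifs
        · rw [Finset.card_insert_of_notMem (haB i)]; push_cast; ring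
        · ring
      have hc : ∀ i, ∑ b ∈ B' i, c b = ∑ b ∈ B i, c b + δ i * c a := by
        intro i
        simp only [hB', hδ]
        split_ifs
        · rw [Finset.sum_insert (haB i)]; ring
        · ring
      have h1 : ∑ i, w i * ((B' i).card : ℝ) = ∑ i, w i * ((B i).card : ℝ) + ∑ i, w i * δ i := by
        rw [← Finset.sum_add_distrib]
        exact Finset.sum_congr rfl fun i _ => by rw [hcard]; ring
      have h2 : ∑ i, w i * ∑ b ∈ B' i, c b =
          ∑ i, w i * ∑ b ∈ B i, c b + (∑ i, w i * δ i) * c a := by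
        rw [Finset.sum_mul, ← Finset.sum_add_distrib]
        exact Finset.sum_congr rfl fun i _ => by rw [hc]; ring
      -- Since a is cheapest, the old invariant is available at rate c a. Its budget grows by q and
      -- pays for the removals of a; lowering the rate to γ only helps because the new slack is
      -- nonnegative.
      have hIH := hsum (c a) hmin
      have hγa := hγ a (Finset.mem_insert_self a P)
      rw [h1, Finset.card_insert_of_notMem haP] at hslack
      rw [h1, h2, Finset.sum_insert haP, Finset.card_insert_of_notMem haP]
      push_cast at hslack ⊢
      nlinarith [mul_nonneg (sub_nonneg.2 hγa) (sub_nonneg.2 hslack)]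

/-- Weighted form of the generalized Rota exchange property. -/
theorem exists_matroid_removal {M : Matroid V} (hE : M.E = Set.univ) {X Y : Finset V}
    (hX : M.Indep (X : Set V)) (hY : M.Indep (Y : Set V)) {ι : Type*} [Fintype ι] {w : ι → ℝ}
    (hw : ∀ i, 0 ≤ w i) {A : ι → Finset V} (hA : ∀ i, A i ⊆ Y \ X) {q : ℝ} (hq : 0 ≤ q)
    (hcov : ∀ x ∈ Y \ X, ∑ i, (if x ∈ A i then w i else 0) = q) (c : V → ℝ)
    (hc : ∀ x, 0 ≤ c x) :
    ∃ B : ι → Finset V, (∀ i, B i ⊆ X \ Y) ∧ (∀ i, (B i).card ≤ (A i).card) ∧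
      (∀ i, M.Indep ((X \ B i ∪ A i : Finset V) : Set V)) ∧
      ∑ i, w i * ∑ b ∈ B i, c b ≤ q * ∑ b ∈ X \ Y, c b := by
  obtain ⟨B, hB, hind, hcl, hsum⟩ :=
    exists_greedy_removal hE hX hY hw hA hq hcov c (X \ Y) subset_rfl
  have hset : ∀ i, (X ∩ Y) ∪ ((X \ Y) \ B i) ∪ A i = X \ B i ∪ A i := by
    intro i
    ext x
    have := @hB i x
    simp only [Finset.mem_union, Finset.mem_inter, Finset.mem_sdiff] at this ⊢
    tauto
  simp only [hset] at hind hcl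
  refine ⟨B, hB, fun i => ?_, hind, by simpa using hsum 0 fun x _ => hc x⟩
  -- X is still spanned after the exchange, so no more elements are removed than added.
  have hle := card_le_card_of_subset_closure (M := M) (I := X) (J := X \ B i ∪ A i) hX (by
    intro x hx
    by_cases hxY : x ∈ Y
    · refine M.mem_closure_of_mem' ?_ (by simp [hE])
      have : x ∉ B i := fun h => (Finset.mem_sdiff.1 (hB i h)).2 hxY
      simp [this, Finset.mem_coe.1 hx]
    · exact hcl i (by simpa [hxY] using hx))
  have hBX : B i ⊆ X := (hB i).trans Finset.sdiff_subset
  have := Finset.card_union_le (X \ B i) (A i)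
  rw [Finset.card_sdiff_of_subset hBX] at this
  have := Finset.card_le_card hBX
  omega

end MatroidRemoval

/-! ### Intersections of p matroids -/

section Families

variable {V : Type} [DecidableEq V] [Fintype V]

lemma sum_weight_cost_le {ι : Type*} [Fintype ι] {w : ι → ℝ} {B : ι → Finset V} {R : Finset V}
    {k : ℝ} (hB : ∀ i, B i ⊆ R)
    (hcov : ∀ x ∈ R, ∑ i, (if x ∈ B i then w i else 0) ≤ k) {c : V → ℝ} (hc : ∀ x, 0 ≤ c x) :
    ∑ i, w i * ∑ b ∈ B i, c b ≤ k * ∑ b ∈ R, c b := by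
  calc ∑ i, w i * ∑ b ∈ B i, c b = ∑ i, ∑ b ∈ R, c b * (if b ∈ B i then w i else 0) := by
        refine Finset.sum_congr rfl fun i _ => ?_
        simp only [mul_ite, mul_zero]
        rw [Finset.sum_ite_mem, Finset.inter_eq_right.2 (hB i), Finset.mul_sum]
        exact Finset.sum_congr rfl fun b _ => mul_comm _ _
    _ = ∑ b ∈ R, c b * ∑ i, (if b ∈ B i then w i else 0) := by
        rw [Finset.sum_comm]
        exact Finset.sum_congr rfl fun b _ => (Finset.mul_sum _ _ _).symm
    _ ≤ ∑ b ∈ R, c b * k :=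
        Finset.sum_le_sum fun b hb => mul_le_mul_of_nonneg_left (hcov b hb) (hc b)
    _ = k * ∑ b ∈ R, c b := by rw [← Finset.sum_mul, mul_comm]

lemma sum_biUnion_le_sum {κ : Type*} {c : V → ℝ} (hc : ∀ x, 0 ≤ c x) (O : Finset κ)
    (C : κ → Finset V) : ∑ b ∈ O.biUnion C, c b ≤ ∑ l ∈ O, ∑ b ∈ C l, c b := by
  classical
  induction O using Finset.induction_on with
  | empty => simp
  | insert l O hl ih =>
    rw [Finset.biUnion_insert, Finset.sum_insert hl]
    refine le_trans ?_ (add_le_add le_rfl ih)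
    rw [← Finset.sum_union_inter]
    exact le_add_of_nonneg_right (Finset.sum_nonneg fun b _ => hc b)

/-- There is a weighted family of exchanges `(A, B)` with the property `feas`, in which the sets
`A` cover `Y \ X` with total weight `q` and the sets `B` cost at most `k` times `X \ Y`. -/
def HasCheapFamily (feas : Finset V → Finset V → Prop) (X Y : Finset V) (q k : ℝ) (c : V → ℝ) :
    Prop :=
  ∃ (ι : Type) (_ : Fintype ι) (w : ι → ℝ) (A B : ι → Finset V),
    (∀ i, 0 ≤ w i) ∧ (∀ i, A i ⊆ Y \ X) ∧ (∀ i, B i ⊆ X \ Y) ∧ (∀ i, feas (A i) (B i)) ∧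
    (∀ x ∈ Y \ X, ∑ i, (if x ∈ A i then w i else 0) = q) ∧
    ∑ i, w i * ∑ b ∈ B i, c b ≤ k * ∑ b ∈ X \ Y, c b

/-- The exchange property of the intersection of `p ≥ 2` matroids. -/
theorem cheapFamily_matroids {p q : ℕ} (hp : 2 ≤ p) (hq : 1 ≤ q) (𝓜 : Fin p → Matroid V)
    (hE : ∀ l, (𝓜 l).E = Set.univ) {X Y : Finset V} (hX : ∀ l, (𝓜 l).Indep (X : Set V))
    (hY : ∀ l, (𝓜 l).Indep (Y : Set V)) {c : V → ℝ} (hc : ∀ x, 0 ≤ c x) :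
    HasCheapFamily (fun A B => A.card ≤ q ∧ B.card ≤ p * q ∧
      ∀ l, (𝓜 l).Indep ((X \ B ∪ A : Finset V) : Set V)) X Y q ((p - 1) * q + 1) c := by
  classical
  set l₀ : Fin p := ⟨0, by omega⟩ with hl₀
  set l₁ : Fin p := ⟨1, by omega⟩ with hl₁
  obtain ⟨ι, _, w, A, B, hw, hfeas, hcov, hcost⟩ :=
    exchangeFamily_two_matroids (hE l₀) (hE l₁) (hX l₀) (hX l₁) (hY l₀) (hY l₁) hq
  have hA : ∀ i, A i ⊆ Y \ X := fun i => (hfeas i).1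
  have hcov' : ∀ x ∈ Y \ X, ∑ i, (if x ∈ A i then w i else 0) = (q : ℝ) := by
    intro x hx
    exact (hcov x).trans (if_pos hx)
  choose C hCsub hCcard hCind hCcost using fun l : Fin p =>
    exists_matroid_removal (hE l) (hX l) (hY l) hw hA (Nat.cast_nonneg q) hcov' c hc
  -- The remaining p - 2 matroids reuse the sets A of the two-matroid family; each only adds its own
  -- removals, of cost at most q times that of X \ Y.
  set O : Finset (Fin p) := Finset.univ \ {l₀, l₁} with hO
  have hOcard : O.card = p - 2 := by
    have hne : l₀ ≠ l₁ := by simp [hl₀, hl₁]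
    rw [hO, Finset.card_sdiff_of_subset (Finset.subset_univ _), Finset.card_pair hne,
      Finset.card_univ, Fintype.card_fin]
  refine ⟨ι, inferInstance, w, A, fun i => B i ∪ O.biUnion fun l => C l i, hw, hA, fun i => ?_,
    fun i => ⟨(hfeas i).2.2.1, ?_, fun l => ?_⟩, hcov', ?_⟩
  · exact Finset.union_subset (hfeas i).2.1 (Finset.biUnion_subset.2 fun l _ => hCsub l i)
  · refine (Finset.card_union_le _ _).trans ?_
    have h1 : (O.biUnion fun l => C l i).card ≤ O.card * q :=
      Finset.card_biUnion_le_card_mul _ _ _ fun l _ => (hCcard l i).trans (hfeas i).2.2.1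
    have h2 := (hfeas i).2.2.2.1
    rw [hOcard] at h1
    obtain ⟨r, rfl⟩ := Nat.exists_eq_add_of_le hp
    rw [Nat.add_sub_cancel_left] at h1
    linarith [add_mul 2 r q]
  · by_cases hl : l ∈ O
    · refine (hCind l i).subset ?_
      have : C l i ⊆ B i ∪ O.biUnion fun l => C l i :=
        (Finset.subset_biUnion_of_mem (fun l => C l i) hl).trans Finset.subset_union_right
      exact_mod_cast Finset.union_subset_union (Finset.sdiff_subset_sdiff subset_rfl this)
        subset_rfl
    · have hsub : X \ (B i ∪ O.biUnion fun l => C l i) ∪ A i ⊆ X \ B i ∪ A i :=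
        Finset.union_subset_union (Finset.sdiff_subset_sdiff subset_rfl Finset.subset_union_left)
          subset_rfl
      have : l = l₀ ∨ l = l₁ := by
        by_contra hcon
        exact hl (by simpa [hO] using hcon)
      rcases this with rfl | rfl
      · exact (hfeas i).2.2.2.2.1.subset (by exact_mod_cast hsub)
      · exact (hfeas i).2.2.2.2.2.subset (by exact_mod_cast hsub)
  · have hBcost : ∑ i, w i * ∑ b ∈ B i, c b ≤ ((q : ℝ) + 1) * ∑ b ∈ X \ Y, c b := by
      refine sum_weight_cost_le (fun i => (hfeas i).2.1) (fun x hx => ?_) hc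
      exact (hcost x).trans_eq (if_pos hx)
    have hunion : ∀ i, ∑ b ∈ B i ∪ O.biUnion (fun l => C l i), c b ≤
        ∑ b ∈ B i, c b + ∑ l ∈ O, ∑ b ∈ C l i, c b := by
      intro i
      have h1 : ∑ b ∈ B i ∪ O.biUnion (fun l => C l i), c b ≤
          ∑ b ∈ B i, c b + ∑ b ∈ O.biUnion (fun l => C l i), c b := by
        rw [← Finset.sum_union_inter]
        exact le_add_of_nonneg_right (Finset.sum_nonneg fun b _ => hc b)
      exact h1.trans (add_le_add le_rfl (sum_biUnion_le_sum hc O fun l => C l i))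
    calc ∑ i, w i * ∑ b ∈ B i ∪ O.biUnion (fun l => C l i), c b
        ≤ ∑ i, (w i * ∑ b ∈ B i, c b + ∑ l ∈ O, w i * ∑ b ∈ C l i, c b) := by
          refine Finset.sum_le_sum fun i _ => ?_
          rw [← Finset.mul_sum, ← mul_add]
          exact mul_le_mul_of_nonneg_left (hunion i) (hw i)
      _ = ∑ i, w i * ∑ b ∈ B i, c b + ∑ l ∈ O, ∑ i, w i * ∑ b ∈ C l i, c b := by
          rw [Finset.sum_add_distrib, Finset.sum_comm (s := O)]
      _ ≤ ((q : ℝ) + 1) * ∑ b ∈ X \ Y, c b + ∑ l ∈ O, (q : ℝ) * ∑ b ∈ X \ Y, c b :=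
          add_le_add hBcost (Finset.sum_le_sum fun l _ => hCcost l)
      _ = ((p - 1) * q + 1) * ∑ b ∈ X \ Y, c b := by
          rw [Finset.sum_const, hOcard, nsmul_eq_mul, Nat.cast_sub hp]
          push_cast
          ring

end Families

/-! ### Bipartite graphs of bounded degree and exchange systems -/

section BoundedDegree

variable {V : Type} [DecidableEq V] [Fintype V]

/-- The support of a regular nonnegative integer matrix contains a perfect matching. -/
lemma exists_perm_of_regular (Q : V → V → ℕ) {r : ℕ} (hr : 0 < r) (hrow : ∀ i, ∑ j, Q i j = r)
    (hcol : ∀ j, ∑ i, Q i j = r) : ∃ σ : Equiv.Perm V, ∀ i, 0 < Q i (σ i) := by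
  have hall : ∀ K : Finset V,
      K.card ≤ (K.biUnion fun i => Finset.univ.filter fun j => 0 < Q i j).card := by
    intro K
    set N := K.biUnion fun i => Finset.univ.filter fun j => 0 < Q i j with hN
    have h1 : ∀ i ∈ K, ∑ j ∈ N, Q i j = r := by
      intro i hi
      rw [← hrow i]
      refine Finset.sum_subset (Finset.subset_univ _) fun j _ hj => ?_
      by_contra hne
      exact hj (Finset.mem_biUnion.2 ⟨i, hi, by simpa using Nat.pos_of_ne_zero hne⟩)
    have h2 : ∑ i ∈ K, ∑ j ∈ N, Q i j ≤ ∑ j ∈ N, r := by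
      rw [Finset.sum_comm]
      refine Finset.sum_le_sum fun j _ => ?_
      rw [← hcol j]
      exact Finset.sum_le_sum_of_subset (Finset.subset_univ _)
    rw [Finset.sum_congr rfl h1, Finset.sum_const, Finset.sum_const, smul_eq_mul,
      smul_eq_mul] at h2
    exact Nat.le_of_mul_le_mul_right h2 hr
  obtain ⟨f, hf, hft⟩ := (Finset.all_card_le_biUnion_card_iff_exists_injective _).1 hall
  exact ⟨Equiv.ofBijective f (Finite.injective_iff_bijective.1 hf), fun i => by simpa using hft i⟩

/-- Subtracting one permutation matrix leaves an (r - 1)-regular matrix with r - 1 ≥ 1; a common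
value of both permutations uses an entry twice. -/
lemma exists_two_perms_of_regular (Q : V → V → ℕ) {r : ℕ} (hr : 2 ≤ r)
    (hrow : ∀ i, ∑ j, Q i j = r) (hcol : ∀ j, ∑ i, Q i j = r) :
    ∃ σ₁ σ₂ : Equiv.Perm V, (∀ i, 0 < Q i (σ₁ i)) ∧ (∀ i, 0 < Q i (σ₂ i)) ∧
      ∀ i, σ₁ i = σ₂ i → 2 ≤ Q i (σ₁ i) := by
  obtain ⟨σ₁, h₁⟩ := exists_perm_of_regular Q (by omega) hrow hcol
  have hadd : ∀ i j, (Q i j - if σ₁ i = j then 1 else 0) + (if σ₁ i = j then 1 else 0) = Q i j := by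
    intro i j
    refine Nat.sub_add_cancel ?_
    split_ifs with h
    · exact h ▸ h₁ i
    · exact Nat.zero_le _
  obtain ⟨σ₂, h₂⟩ := exists_perm_of_regular (fun i j => Q i j - if σ₁ i = j then 1 else 0)
    (r := r - 1) (by omega)
    (fun i => by
      have : ∑ j, (Q i j - if σ₁ i = j then 1 else 0) + ∑ j, (if σ₁ i = j then 1 else 0) = r := by
        rw [← Finset.sum_add_distrib, ← hrow i]
        exact Finset.sum_congr rfl fun j _ => hadd i j
      rw [Finset.sum_ite_eq, if_pos (Finset.mem_univ _)] at this
      omega)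
    (fun j => by
      have : ∑ i, (Q i j - if σ₁ i = j then 1 else 0) + ∑ i, (if σ₁ i = j then 1 else 0) = r := by
        rw [← Finset.sum_add_distrib, ← hcol j]
        exact Finset.sum_congr rfl fun i _ => hadd i j
      rw [Finset.sum_eq_single (σ₁.symm j) (fun i _ hi => if_neg fun h => hi (by simp [← h]))
        (by simp), Equiv.apply_symm_apply, if_pos rfl] at this
      omega)
  refine ⟨σ₁, σ₂, h₁, fun i => (h₂ i).trans_le (Nat.sub_le _ _), fun i hi => ?_⟩
  have := h₂ i
  rw [if_pos hi] at this
  rw [hi]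
  omega

/-- In a bipartite graph of maximum degree at most `p ≥ 2` there are two permutations along edges
and fixed points such that every vertex of degree `p` is moved to two different neighbours. -/
lemma exists_two_perms_of_degree_le {p : ℕ} (hp : 2 ≤ p) (adj : V → V → Prop)
    (hsymm : ∀ i j, adj i j → adj j i) (hirr : ∀ i, ¬ adj i i) (deg : V → ℕ)
    (hdeg : ∀ i, deg i = Nat.card {j // adj i j}) (hle : ∀ i, deg i ≤ p) :
    ∃ σ₁ σ₂ : Equiv.Perm V, (∀ i, adj i (σ₁ i) ∨ σ₁ i = i ∧ deg i < p) ∧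
      (∀ i, adj i (σ₂ i) ∨ σ₂ i = i ∧ deg i < p) ∧ ∀ i, adj i (σ₁ i) → σ₁ i ≠ σ₂ i := by
  classical
  have hdeg' : ∀ i, ∑ j, (if adj i j then 1 else 0) = deg i := by
    intro i
    rw [hdeg, Nat.card_eq_fintype_card, Fintype.card_subtype, Finset.card_filter]
  -- Loops make the adjacency matrix p-regular. Vertices of degree p get none, and genuine edges
  -- have multiplicity 1, so the two permutations cannot share one.
  set Q : V → V → ℕ := fun i j => (if adj i j then 1 else 0) + if i = j then p - deg i else 0
    with hQ
  have hrow : ∀ i, ∑ j, Q i j = p := by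
    intro i
    rw [Finset.sum_add_distrib, hdeg', Finset.sum_ite_eq, if_pos (Finset.mem_univ _)]
    have := hle i
    omega
  have hQsymm : ∀ i j, Q i j = Q j i := by
    intro i j
    simp only [hQ]
    rw [if_congr (⟨hsymm i j, hsymm j i⟩ : adj i j ↔ adj j i) rfl rfl]
    by_cases h : i = j
    · subst h; rfl
    · rw [if_neg h, if_neg (Ne.symm h)]
  obtain ⟨σ₁, σ₂, h₁, h₂, h₁₂⟩ := exists_two_perms_of_regular Q hp hrow fun j => by
    rw [← hrow j]
    exact Finset.sum_congr rfl fun i _ => hQsymm i j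
  have hpos : ∀ i j, 0 < Q i j → adj i j ∨ j = i ∧ deg i < p := by
    intro i j h
    by_cases hadj : adj i j
    · exact Or.inl hadj
    · simp only [hQ, if_neg hadj] at h
      split_ifs at h with hij
      · exact Or.inr ⟨hij.symm, by omega⟩
      · omega
  refine ⟨σ₁, σ₂, fun i => hpos _ _ (h₁ i), fun i => hpos _ _ (h₂ i), fun i hadj heq => ?_⟩
  have h := h₁₂ i heq
  have hne : i ≠ σ₁ i := fun h' => hirr i (by rw [← h'] at hadj; exact hadj)
  simp only [hQ, if_pos hadj, if_neg hne] at h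
  omega

lemma orbitWindow_succ (τ : Equiv.Perm V) (k : ℕ) (v : V) :
    orbitWindow τ (k + 1) v = insert ((τ ^ k) v) (orbitWindow τ k v) := by
  rw [orbitWindow, Finset.range_add_one, Finset.image_insert]; rfl

/-- Along a window, consecutive vertices share a neighbour. -/
lemma card_neighbours_orbitWindow {p : ℕ} (hp : 2 ≤ p) {A B : Finset V} {φ : V → Finset V}
    (hφp : ∀ v ∈ A, (φ v).card ≤ p) {σ₁ σ₂ τ : Equiv.Perm V} (hστ : ∀ x, σ₂ (τ x) = σ₁ x)
    (h₁ : ∀ x ∈ A, σ₁ x ∈ B → σ₁ x ∈ φ x)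
    (h₂ : ∀ x ∈ A, σ₂ x ∈ B ∧ σ₂ x ∈ φ x ∨ (φ x).card < p) (k : ℕ) (v : V) :
    (((orbitWindow τ (k + 1) v ∩ A).biUnion φ) ∪ ({σ₁ ((τ ^ k) v)} ∩ B)).card ≤
      (p - 1) * (k + 1) + 1 := by
  induction k with
  | zero =>
    have hw : orbitWindow τ (0 + 1) v = {v} := by
      rw [orbitWindow_succ]; simp [orbitWindow]
    rw [hw, zero_add, mul_one, pow_zero, Equiv.Perm.one_apply]
    by_cases hv : v ∈ A
    · refine (Finset.card_le_card (t := φ v) ?_).trans ((hφp v hv).trans (by omega))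
      rw [Finset.singleton_inter_of_mem hv, Finset.singleton_biUnion]
      refine Finset.union_subset subset_rfl fun y hy => ?_
      rw [Finset.mem_inter, Finset.mem_singleton] at hy
      obtain ⟨rfl, hy⟩ := hy
      exact h₁ v hv hy
    · rw [Finset.singleton_inter_of_notMem hv, Finset.biUnion_empty, Finset.empty_union]
      exact (Finset.card_le_card Finset.inter_subset_left).trans (by simp)
  | succ k ih =>
    set x := (τ ^ (k + 1)) v with hx
    have hσ₂x : σ₂ x = σ₁ ((τ ^ k) v) := by
      rw [hx, pow_succ', Equiv.Perm.mul_apply, hστ]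
    rw [← hσ₂x] at ih
    set U := ((orbitWindow τ (k + 1) v ∩ A).biUnion φ) ∪ ({σ₂ x} ∩ B) with hU
    -- Each new point brings at most p - 1 new elements. If x lies in A and has p neighbours, σ₂ x
    -- is one of them and was already counted as the σ₁-image of the preceding point; the extra
    -- singleton in the statement keeps this shared element available. If x is not in A, only the
    -- singleton {σ₁ x} can be new, and p ≥ 2.
    have hstep : ∃ D : Finset V, D.card ≤ p - 1 ∧
        ((orbitWindow τ (k + 1 + 1) v ∩ A).biUnion φ) ∪ ({σ₁ x} ∩ B) ⊆ U ∪ D := by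
      rw [orbitWindow_succ, ← hx]
      by_cases hxA : x ∈ A
      · have hsub : ((insert x (orbitWindow τ (k + 1) v) ∩ A).biUnion φ) ∪ ({σ₁ x} ∩ B) ⊆
            ((orbitWindow τ (k + 1) v ∩ A).biUnion φ) ∪ φ x := by
          rw [Finset.insert_inter_of_mem hxA, Finset.biUnion_insert]
          refine Finset.union_subset (Finset.union_comm _ _).subset fun y hy => ?_
          rw [Finset.mem_inter, Finset.mem_singleton] at hy
          obtain ⟨rfl, hy⟩ := hy
          exact Finset.mem_union_right _ (h₁ x hxA hy)
        rcases h₂ x hxA with ⟨hyB, hyφ⟩ | hlt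
        · refine ⟨φ x \ {σ₂ x}, ?_, hsub.trans fun y hy => ?_⟩
          · rw [Finset.card_sdiff_of_subset (Finset.singleton_subset_iff.2 hyφ),
              Finset.card_singleton]
            have := hφp x hxA
            omega
          · rw [Finset.mem_union] at hy
            by_cases hyx : y = σ₂ x
            · subst hyx
              exact Finset.mem_union_left _ (Finset.mem_union_right _
                (Finset.mem_inter.2 ⟨Finset.mem_singleton_self _, hyB⟩))
            · rcases hy with hy | hy
              · exact Finset.mem_union_left _ (Finset.mem_union_left _ hy)
              · exact Finset.mem_union_right _ (Finset.mem_sdiff.2 ⟨hy, by simpa using hyx⟩)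
        · exact ⟨φ x, by omega, hsub.trans (Finset.union_subset_union Finset.subset_union_left
            subset_rfl)⟩
      · refine ⟨{σ₁ x}, by rw [Finset.card_singleton]; omega, ?_⟩
        rw [Finset.insert_inter_of_notMem hxA]
        exact Finset.union_subset_union Finset.subset_union_left Finset.inter_subset_left
    obtain ⟨D, hD, hsub⟩ := hstep
    have := (Finset.card_le_card hsub).trans (Finset.card_union_le _ _)
    rw [mul_add (p - 1) (k + 1) 1]
    omega

/-- With at most p - 1 points the union bound gives (p - 1)q. With p points, two consecutive ones
cost q + 1 together and the other p - 2 cost q each. -/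
lemma sum_windowWeight_meets {p q : ℕ} (hq : 1 ≤ q) (τ : Equiv.Perm V)
    {N : Finset V} (hN : N.card + 1 ≤ p ∨ N.card = p ∧ ∃ a ∈ N, τ a ∈ N ∧ a ≠ τ a) :
    ∑ v, (if ∃ x ∈ N, x ∈ orbitWindow τ q v then windowWeight τ q v else 0) ≤
      ((p : ℝ) - 1) * q + 1 := by
  have hsum : ∀ K : Finset V, ∑ v, ∑ x ∈ K,
      (if x ∈ orbitWindow τ q v then windowWeight τ q v else 0) = K.card * q := by
    intro K
    rw [Finset.sum_comm, Finset.sum_congr rfl fun x _ => sum_windowWeight hq τ x,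
      Finset.sum_const, nsmul_eq_mul]
  have hterm : ∀ x v, 0 ≤ if x ∈ orbitWindow τ q v then windowWeight τ q v else 0 := by
    intro x v
    split_ifs
    exacts [windowWeight_nonneg τ q v, le_rfl]
  have hone : ∀ (K : Finset V) v, ∀ x ∈ K, x ∈ orbitWindow τ q v → windowWeight τ q v ≤
      ∑ x ∈ K, (if x ∈ orbitWindow τ q v then windowWeight τ q v else 0) := by
    intro K v x hx hxv
    have := Finset.single_le_sum
      (f := fun x => if x ∈ orbitWindow τ q v then windowWeight τ q v else 0)
      (fun y _ => hterm y v) hx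
    simpa only [if_pos hxv] using this
  rcases hN with hlt | ⟨hfull, a, haN, haN', hne⟩
  · have hlt' : (N.card : ℝ) + 1 ≤ p := by exact_mod_cast hlt
    calc _ ≤ ∑ v, ∑ x ∈ N, (if x ∈ orbitWindow τ q v then windowWeight τ q v else 0) := by
          refine Finset.sum_le_sum fun v _ => ?_
          split_ifs with hbv
          · obtain ⟨x, hxN, hxv⟩ := hbv
            exact hone N v x hxN hxv
          · exact Finset.sum_nonneg fun x _ => hterm x v
      _ = N.card * q := hsum N
      _ ≤ (p - 1) * q := mul_le_mul_of_nonneg_right (by linarith) (Nat.cast_nonneg q)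
      _ ≤ (p - 1) * q + 1 := by linarith
  · have hpair : ({a, τ a} : Finset V) ⊆ N := by
      intro x hx
      rw [Finset.mem_insert, Finset.mem_singleton] at hx
      rcases hx with rfl | rfl <;> assumption
    have hNcard : ((N \ {a, τ a}).card : ℝ) = p - 2 := by
      have h2 := Finset.card_le_card hpair
      rw [Finset.card_pair hne] at h2
      rw [Finset.card_sdiff_of_subset hpair, Finset.card_pair hne, Nat.cast_sub h2, hfull]
      norm_num
    calc _ ≤ ∑ v, ((if a ∈ orbitWindow τ q v ∨ τ a ∈ orbitWindow τ q v then windowWeight τ q v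
            else 0) + ∑ x ∈ N \ {a, τ a},
              (if x ∈ orbitWindow τ q v then windowWeight τ q v else 0)) := by
          refine Finset.sum_le_sum fun v _ => ?_
          have hnn : 0 ≤ ∑ x ∈ N \ {a, τ a},
              (if x ∈ orbitWindow τ q v then windowWeight τ q v else 0) :=
            Finset.sum_nonneg fun x _ => hterm x v
          by_cases hor : a ∈ orbitWindow τ q v ∨ τ a ∈ orbitWindow τ q v
          · rw [if_pos hor]
            refine le_add_of_le_of_nonneg ?_ hnn
            split_ifs
            exacts [le_rfl, windowWeight_nonneg τ q v]
          · rw [if_neg hor, zero_add]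
            split_ifs with hbv
            · obtain ⟨x, hxN, hxv⟩ := hbv
              refine hone _ v x (Finset.mem_sdiff.2 ⟨hxN, ?_⟩) hxv
              rw [Finset.mem_insert, Finset.mem_singleton]
              rintro (rfl | rfl)
              exacts [hor (Or.inl hxv), hor (Or.inr hxv)]
            · exact hnn
      _ ≤ (q + 1) + (p - 2) * q := by
          rw [Finset.sum_add_distrib, hsum, hNcard]
          exact add_le_add (sum_windowWeight_consecutive hq τ a) le_rfl
      _ = (p - 1) * q + 1 := by ring

/-- The exchange property of `p`-exchange systems. -/
theorem cheapFamily_of_degree_le {p q : ℕ} (hp : 2 ≤ p) (hq : 1 ≤ q) {X Y : Finset V}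
    (φ : V → Finset V) (hφ : ∀ v ∈ Y \ X, φ v ⊆ X \ Y) (hφp : ∀ v ∈ Y \ X, (φ v).card ≤ p)
    (hφp' : ∀ v ∈ X \ Y, ((Y \ X).filter fun x => v ∈ φ x).card ≤ p)
    {c : V → ℝ} (hc : ∀ x, 0 ≤ c x) :
    HasCheapFamily (fun A B => A.card ≤ q ∧ B.card ≤ (p - 1) * q + 1 ∧ B = A.biUnion φ)
      X Y q ((p - 1) * q + 1) c := by
  classical
  set adj : V → V → Prop := fun i j =>
    (i ∈ Y \ X ∧ j ∈ φ i) ∨ (j ∈ Y \ X ∧ i ∈ φ j) with hadj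
  have hdisj : ∀ x, x ∈ X \ Y → x ∉ Y \ X := fun x hx hx' =>
    (Finset.mem_sdiff.1 hx).2 (Finset.mem_sdiff.1 hx').1
  have hadjA : ∀ i ∈ Y \ X, ∀ j, adj i j ↔ j ∈ φ i := by
    intro i hi j
    refine ⟨?_, fun h => Or.inl ⟨hi, h⟩⟩
    rintro (⟨-, h⟩ | ⟨hj, h⟩)
    · exact h
    · exact absurd hi (hdisj i (hφ j hj h))
  have hadjB : ∀ i ∈ X \ Y, ∀ j, adj i j ↔ j ∈ (Y \ X).filter fun x => i ∈ φ x := by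
    intro i hi j
    rw [Finset.mem_filter]
    refine ⟨?_, fun h => Or.inr h⟩
    rintro (⟨h, -⟩ | h)
    · exact absurd h (hdisj i hi)
    · exact h
  have hadjN : ∀ i, i ∉ Y \ X → i ∉ X \ Y → ∀ j, ¬ adj i j := by
    rintro i h1 h2 j (⟨h, -⟩ | ⟨hj, h⟩)
    · exact h1 h
    · exact h2 (hφ j hj h)
  set deg : V → ℕ := fun i => Nat.card {j // adj i j} with hdeg
  have hdegA : ∀ i ∈ Y \ X, deg i = (φ i).card := by
    intro i hi
    simp only [hdeg, hadjA i hi]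
    simp
  have hdegB : ∀ i ∈ X \ Y, deg i = ((Y \ X).filter fun x => i ∈ φ x).card := by
    intro i hi
    simp only [hdeg, hadjB i hi]
    rw [Nat.card_eq_fintype_card, Fintype.card_coe]
  have hle : ∀ i, deg i ≤ p := by
    intro i
    by_cases h1 : i ∈ Y \ X
    · rw [hdegA i h1]; exact hφp i h1
    by_cases h2 : i ∈ X \ Y
    · rw [hdegB i h2]; exact hφp' i h2
    · have : IsEmpty {j // adj i j} := ⟨fun j => hadjN i h1 h2 j.1 j.2⟩
      simp [hdeg]
  obtain ⟨σ₁, σ₂, h₁, h₂, h₁₂⟩ := exists_two_perms_of_degree_le hp adj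
    (fun i j h => h.symm) (fun i h => by
      rcases h with ⟨h, h'⟩ | ⟨h, h'⟩ <;> exact hdisj i (hφ i h h') h) deg (fun _ => rfl) hle
  set τ : Equiv.Perm V := σ₂⁻¹ * σ₁ with hτ
  have hστ : ∀ x, σ₂ (τ x) = σ₁ x := by intro x; simp [hτ]
  have hcard := card_neighbours_orbitWindow (B := X \ Y) hp hφp hστ
    (fun x hx hB => by
      rcases h₁ x with h | ⟨h, -⟩
      · exact (hadjA x hx _).1 h
      · exact absurd hx (hdisj x (h ▸ hB)))
    (fun x hx => by
      rcases h₂ x with h | ⟨-, h⟩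
      · have := (hadjA x hx _).1 h
        exact Or.inl ⟨hφ x hx this, this⟩
      · exact Or.inr (hdegA x hx ▸ h))
  have hmemA : ∀ {x v}, x ∈ Y \ X → (x ∈ orbitWindow τ q v ∩ (Y \ X) ↔ x ∈ orbitWindow τ q v) :=
    fun hx => by rw [Finset.mem_inter, and_iff_left hx]
  have hBsub : ∀ v, (orbitWindow τ q v ∩ (Y \ X)).biUnion φ ⊆ X \ Y := fun v =>
    Finset.biUnion_subset.2 fun x hx => hφ x (Finset.mem_inter.1 hx).2
  refine ⟨V, inferInstance, windowWeight τ q, fun v => orbitWindow τ q v ∩ (Y \ X),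
    fun v => (orbitWindow τ q v ∩ (Y \ X)).biUnion φ, windowWeight_nonneg τ q,
    fun v => Finset.inter_subset_right, hBsub,
    fun v => ⟨(Finset.card_le_card Finset.inter_subset_left).trans (card_orbitWindow_le τ q v),
      ?_, rfl⟩, fun x hx => ?_, ?_⟩
  · obtain ⟨k, rfl⟩ := Nat.exists_eq_add_of_le' hq
    exact (Finset.card_le_card Finset.subset_union_left).trans (hcard k v)
  · simp only [hmemA hx]
    exact sum_windowWeight hq τ x
  · refine sum_weight_cost_le hBsub (fun b hb => ?_) hc
    set N := (Y \ X).filter fun x => b ∈ φ x with hN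
    have hmem : ∀ v, b ∈ (orbitWindow τ q v ∩ (Y \ X)).biUnion φ ↔
        ∃ x ∈ N, x ∈ orbitWindow τ q v := by
      intro v
      simp only [Finset.mem_biUnion, hN, Finset.mem_filter, Finset.mem_inter]
      exact ⟨fun ⟨x, ⟨h, h'⟩, hb⟩ => ⟨x, ⟨h', hb⟩, h⟩, fun ⟨x, ⟨h', hb⟩, h⟩ => ⟨x, ⟨h, h'⟩, hb⟩⟩
    simp only [hmem]
    refine sum_windowWeight_meets hq τ ?_
    -- A vertex b of full degree p has no loop, so both of its preimages are neighbours. They are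
    -- consecutive under τ, and distinct because σ₁ and σ₂ never use the same edge.
    by_cases hfull : N.card = p
    · refine Or.inr ⟨hfull, ?_⟩
      have hdegb : deg b = p := by rw [hdegB b hb, ← hN, hfull]
      have key : ∀ σ : Equiv.Perm V, (∀ i, adj i (σ i) ∨ σ i = i ∧ deg i < p) →
          adj (σ.symm b) b := by
        intro σ hσ
        have := hσ (σ.symm b)
        rw [Equiv.apply_symm_apply] at this
        rcases this with h | ⟨h, h'⟩
        · exact h
        · rw [← h, hdegb] at h'
          exact absurd h' (lt_irrefl _)
      have hτa : τ (σ₁.symm b) = σ₂.symm b := by simp [hτ]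
      refine ⟨σ₁.symm b, (hadjB b hb _).1 (key σ₁ h₁).symm,
        hτa ▸ (hadjB b hb _).1 (key σ₂ h₂).symm, fun h => ?_⟩
      refine h₁₂ (σ₁.symm b) (by rw [Equiv.apply_symm_apply]; exact key σ₁ h₁) ?_
      rw [← hστ, ← h]
    · have : N.card ≤ p := hφp' b hb
      exact Or.inl (by omega)

end BoundedDegree

/-! ### Restricted concavity and smoothness -/

section Analysis

variable {n : ℕ}

lemma mem_supportedOn {X : Finset (Fin n)} {w : EuclideanSpace ℝ (Fin n)} :
    w ∈ supportedOn X ↔ ∀ i, i ∉ X → w i = 0 := by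
  simp only [supportedOn, supp, Set.mem_ofPred_eq, Finset.subset_iff, Finset.mem_filter,
    Finset.mem_univ, true_and]
  exact forall_congr' fun i => ⟨fun h hi => by_contra fun h0 => hi (h h0),
    fun h h0 => by_contra fun hi => h0 (h hi)⟩

lemma card_supp_le {X : Finset (Fin n)} {w : EuclideanSpace ℝ (Fin n)}
    (h : ∀ i, i ∉ X → w i = 0) : (supp w).card ≤ X.card :=
  Finset.card_le_card (mem_supportedOn.2 h)

lemma norm_sq_eq_sum (v : EuclideanSpace ℝ (Fin n)) : ‖v‖ ^ 2 = ∑ i, v i ^ 2 := by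
  rw [EuclideanSpace.norm_sq_eq]
  simp

lemma inner_eq_sum (v w : EuclideanSpace ℝ (Fin n)) : inner ℝ v w = ∑ i, v i * w i := by
  rw [PiLp.inner_apply]
  exact Finset.sum_congr rfl fun i _ => by simp [mul_comm]

lemma isClosed_supportedOn (X : Finset (Fin n)) : IsClosed (supportedOn X) := by
  have : supportedOn X = ⋂ i, ⋂ (_ : i ∉ X), {w : EuclideanSpace ℝ (Fin n) | w i = 0} := by
    ext w
    simp [mem_supportedOn]
  rw [this]
  refine isClosed_iInter fun i => isClosed_iInter fun _ => ?_
  exact isClosed_eq (by fun_prop) continuous_const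

lemma zero_mem_supportedOn (X : Finset (Fin n)) : (0 : EuclideanSpace ℝ (Fin n)) ∈ supportedOn X :=
  mem_supportedOn.2 fun _ _ => rfl

variable {u : EuclideanSpace ℝ (Fin n) → ℝ} {m M : ℝ} {s t : ℕ}

/-- Concavity at 0 gives u(y) ≤ u(0) as soon as ‖y‖ exceeds 2‖∇u(0)‖/m, so a maximum over a compact
ball is global. -/
lemma exists_isMaxOn_supportedOn (hu : Continuous u) (hm : 0 < m)
    (hconc : RestrictedStronglyConcave u m (Omega n (2 * s) (2 * s))) {X : Finset (Fin n)}
    (hX : X.card ≤ 2 * s) : ∃ w, w ∈ supportedOn X ∧ IsMaxOn u (supportedOn X) w := by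
  set R : ℝ := 2 * ‖gradient u 0‖ / m with hR
  have hR0 : 0 ≤ R := by positivity
  have hcomp : IsCompact (Metric.closedBall 0 R ∩ supportedOn X) :=
    (isCompact_closedBall 0 R).inter_right (isClosed_supportedOn X)
  obtain ⟨w, hw, hmax⟩ := hcomp.exists_isMaxOn
    ⟨0, by simpa using hR0, zero_mem_supportedOn X⟩ hu.continuousOn
  refine ⟨w, hw.2, fun y hy => ?_⟩
  by_cases hyR : ‖y‖ ≤ R
  · exact hmax ⟨by simpa using hyR, hy⟩
  · have h0 : u 0 ≤ u w := hmax ⟨by simpa using hR0, zero_mem_supportedOn X⟩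
    have hy' := mem_supportedOn.1 hy
    have hc := hconc 0 y ⟨by simp [supp], (card_supp_le hy').trans hX,
      (card_supp_le (X := X) fun i hi => by simp [hy' i hi]).trans hX⟩
    rw [sub_zero] at hc
    have hin := real_inner_le_norm (gradient u 0) y
    have hy0 : 2 * ‖gradient u 0‖ < ‖y‖ * m := by
      rw [not_le, hR, div_lt_iff₀ hm] at hyR
      exact hyR
    have : u y ≤ u 0 := by nlinarith [norm_nonneg y]
    exact this.trans h0

lemma maximizer_spec (hu : Continuous u) (hm : 0 < m)
    (hconc : RestrictedStronglyConcave u m (Omega n (2 * s) (2 * s))) {X : Finset (Fin n)}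
    (hX : X.card ≤ 2 * s) : maximizer u X ∈ supportedOn X ∧
      IsMaxOn u (supportedOn X) (maximizer u X) :=
  Classical.epsilon_spec (exists_isMaxOn_supportedOn hu hm hconc hX)

lemma sparseObjective_eq {X : Finset (Fin n)} {w : EuclideanSpace ℝ (Fin n)}
    (hw : w ∈ supportedOn X) (hmax : IsMaxOn u (supportedOn X) w) : sparseObjective u X = u w := by
  refine IsGreatest.csSup_eq ⟨Set.mem_image_of_mem u hw, ?_⟩
  rintro _ ⟨y, hy, rfl⟩
  exact hmax hy

lemma gradient_eq_zero_of_isMaxOn (hu : Differentiable ℝ u) {X : Finset (Fin n)}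
    {w : EuclideanSpace ℝ (Fin n)} (hw : w ∈ supportedOn X)
    (hmax : IsMaxOn u (supportedOn X) w) {i : Fin n} (hi : i ∈ X) : gradient u w i = 0 := by
  set e : EuclideanSpace ℝ (Fin n) := EuclideanSpace.single i 1 with he
  have hline : HasDerivAt (fun r : ℝ => w + r • e) e 0 := by
    simpa using ((hasDerivAt_id (0 : ℝ)).smul_const e).const_add w
  have hgrad : HasGradientAt u (gradient u w) (w + (0 : ℝ) • e) := by
    simpa using (hu w).hasGradientAt
  have hder := hgrad.hasFDerivAt.comp_hasDerivAt (0 : ℝ) hline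
  have hloc : IsLocalMax (u ∘ fun r : ℝ => w + r • e) 0 := by
    refine Filter.Eventually.of_forall fun r => ?_
    have hmem : w + r • e ∈ supportedOn X := by
      refine mem_supportedOn.2 fun j hj => ?_
      have hji : j ≠ i := fun h => hj (h ▸ hi)
      simp [he, mem_supportedOn.1 hw j hj, hji]
    simpa using hmax hmem
  have hinner : inner ℝ (gradient u w) e = (0 : ℝ) := hloc.hasDerivAt_eq_zero hder
  rw [he, EuclideanSpace.inner_single_right] at hinner
  simpa using hinner

lemma normSqOn_nonneg (w : EuclideanSpace ℝ (Fin n)) (X : Finset (Fin n)) : 0 ≤ normSqOn w X :=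
  Finset.sum_nonneg fun _ _ => sq_nonneg _

lemma normSqOn_eq_sum_ite (w : EuclideanSpace ℝ (Fin n)) (X : Finset (Fin n)) :
    normSqOn w X = ∑ i, if i ∈ X then w i ^ 2 else 0 := by
  rw [Finset.sum_ite_mem, Finset.univ_inter, normSqOn]

/-- The surrogate gain is a lower bound for the gain. -/
lemma add_score_le_sparseObjective (hu : ContDiff ℝ 1 u) (hm : 0 < m) (hM : 0 < M)
    (hconc : RestrictedStronglyConcave u m (Omega n (2 * s) (2 * s)))
    (hsmooth : RestrictedSmooth u M (Omega n s t)) {X X' : Finset (Fin n)} (hX : X.card ≤ s)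
    (hX' : X'.card ≤ s) (ht : (X' \ X).card + (X \ X').card ≤ t) :
    sparseObjective u X + score u M X X' ≤ sparseObjective u X' := by
  obtain ⟨hw, hmax⟩ := maximizer_spec hu.continuous hm hconc (X := X) (by omega)
  obtain ⟨hw', hmax'⟩ := maximizer_spec hu.continuous hm hconc (X := X') (by omega)
  rw [sparseObjective_eq hw hmax, sparseObjective_eq hw' hmax', score]
  set w := maximizer u X with hwdef
  set g := gradient u w with hg
  have hw0 := mem_supportedOn.1 hw
  have hg0 : ∀ i ∈ X, g i = 0 := fun i hi =>
    gradient_eq_zero_of_isMaxOn (hu.differentiable (by simp)) hw hmax hi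
  set z : EuclideanSpace ℝ (Fin n) := WithLp.toLp 2 fun i =>
    if i ∈ X' \ X then g i / M else if i ∈ X \ X' then 0 else w i with hz
  have hzi : ∀ i, z i = if i ∈ X' \ X then g i / M else if i ∈ X \ X' then 0 else w i :=
    fun i => rfl
  have hz0 : ∀ i, i ∉ X' → z i = 0 := by
    intro i hi
    rw [hzi]
    by_cases hiX : i ∈ X
    · simp [hi, hiX]
    · simp [hi, hiX, hw0 i hiX]
  have hd0 : ∀ i, i ∉ (X' \ X) ∪ (X \ X') → (w - z) i = 0 := by
    intro i hi
    rw [Finset.mem_union, not_or] at hi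
    rw [PiLp.sub_apply, hzi, if_neg hi.1, if_neg hi.2, sub_self]
  have hsm := hsmooth w z ⟨(card_supp_le hw0).trans hX, (card_supp_le hz0).trans hX',
    (card_supp_le hd0).trans ((Finset.card_union_le _ _).trans ht)⟩
  have hzmax : u z ≤ u (maximizer u X') := hmax' (mem_supportedOn.2 hz0)
  rw [norm_sq_eq_sum, inner_eq_sum] at hsm
  have hterm : ∀ i, g i * (z - w) i - M / 2 * (z - w) i ^ 2 =
      1 / (2 * M) * (if i ∈ X' \ X then g i ^ 2 else 0) -
        M / 2 * (if i ∈ X \ X' then w i ^ 2 else 0) := by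
    intro i
    rw [PiLp.sub_apply, hzi]
    by_cases h1 : i ∈ X' \ X
    · have hiX : i ∉ X := (Finset.mem_sdiff.1 h1).2
      have h2 : i ∉ X \ X' := fun h => hiX (Finset.mem_sdiff.1 h).1
      rw [if_pos h1, if_pos h1, if_neg h2, hw0 i hiX]
      field_simp
      ring
    · rw [if_neg h1, if_neg h1]
      by_cases h2 : i ∈ X \ X'
      · rw [if_pos h2, if_pos h2, hg0 i (Finset.mem_sdiff.1 h2).1]
        ring
      · rw [if_neg h2, if_neg h2]
        ring
  have hsum := Finset.sum_congr (rfl : (Finset.univ : Finset (Fin n)) = _) fun i _ => hterm i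
  rw [Finset.sum_sub_distrib, Finset.sum_sub_distrib, ← Finset.mul_sum, ← Finset.mul_sum,
    ← Finset.mul_sum, ← normSqOn_eq_sum_ite, ← normSqOn_eq_sum_ite] at hsum
  linarith

/-- The concavity bound separates into coordinates. On X the linear term vanishes; on Y \ X
completing the square gives g²/(2m); on X \ Y the maximizer on Y is 0, which leaves -(m/2)w². -/
lemma sparseObjective_le_add (hu : ContDiff ℝ 1 u) (hm : 0 < m)
    (hconc : RestrictedStronglyConcave u m (Omega n (2 * s) (2 * s))) {X Y : Finset (Fin n)}
    (hX : X.card ≤ s) (hY : Y.card ≤ s) :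
    sparseObjective u Y ≤ sparseObjective u X +
      1 / (2 * m) * normSqOn (gradient u (maximizer u X)) (Y \ X) -
        m / 2 * normSqOn (maximizer u X) (X \ Y) := by
  obtain ⟨hw, hmax⟩ := maximizer_spec hu.continuous hm hconc (X := X) (by omega)
  obtain ⟨hy, hmaxy⟩ := maximizer_spec hu.continuous hm hconc (X := Y) (by omega)
  rw [sparseObjective_eq hw hmax, sparseObjective_eq hy hmaxy]
  set w := maximizer u X with hwdef
  set y := maximizer u Y with hydef
  set g := gradient u w with hg
  have hw0 := mem_supportedOn.1 hw
  have hy0 := mem_supportedOn.1 hy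
  have hg0 : ∀ i ∈ X, g i = 0 := fun i hi =>
    gradient_eq_zero_of_isMaxOn (hu.differentiable (by simp)) hw hmax hi
  have hc := hconc w y ⟨(card_supp_le hw0).trans (by omega), (card_supp_le hy0).trans (by omega),
    (card_supp_le (X := X ∪ Y) fun i hi => by
      rw [Finset.mem_union, not_or] at hi
      simp [hw0 i hi.1, hy0 i hi.2]).trans ((Finset.card_union_le _ _).trans (by omega))⟩
  rw [norm_sq_eq_sum, inner_eq_sum] at hc
  have hterm : ∀ i, g i * (y - w) i - m / 2 * (y - w) i ^ 2 ≤
      1 / (2 * m) * (if i ∈ Y \ X then g i ^ 2 else 0) -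
        m / 2 * (if i ∈ X \ Y then w i ^ 2 else 0) := by
    intro i
    rw [PiLp.sub_apply]
    by_cases hiX : i ∈ X
    · rw [hg0 i hiX, if_neg fun h => (Finset.mem_sdiff.1 h).2 hiX]
      by_cases hiY : i ∈ Y
      · rw [if_neg fun h => (Finset.mem_sdiff.1 h).2 hiY]
        have := mul_nonneg hm.le (sq_nonneg (y i - w i))
        linarith
      · rw [if_pos (Finset.mem_sdiff.2 ⟨hiX, hiY⟩), hy0 i hiY]
        exact le_of_eq (by ring)
    · rw [hw0 i hiX, if_neg fun h => hiX (Finset.mem_sdiff.1 h).1, sub_zero]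
      by_cases hiY : i ∈ Y
      · rw [if_pos (Finset.mem_sdiff.2 ⟨hiY, hiX⟩)]
        have h1 : 1 / (2 * m) * g i ^ 2 - (g i * y i - m / 2 * y i ^ 2) =
            1 / (2 * m) * (g i - m * y i) ^ 2 := by
          field_simp
          ring
        have h2 : 0 ≤ 1 / (2 * m) * (g i - m * y i) ^ 2 := by positivity
        linarith
      · rw [if_neg fun h => hiY (Finset.mem_sdiff.1 h).1, hy0 i hiY]
        simp
  have hsum := Finset.sum_le_sum fun i (_ : i ∈ (Finset.univ : Finset (Fin n))) => hterm i
  rw [Finset.sum_sub_distrib, Finset.sum_sub_distrib, ← Finset.mul_sum, ← Finset.mul_sum,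
    ← Finset.mul_sum, ← normSqOn_eq_sum_ite, ← normSqOn_eq_sum_ite] at hsum
  linarith

/-- Apply concavity from w to 0: the gradient is orthogonal to w, so u(w) ≥ u(0) + (m/2)‖w‖². With R
= ∅ this also shows that f is nonnegative. -/
lemma normSqOn_maximizer_le (hu : ContDiff ℝ 1 u) (hu0 : 0 ≤ u 0) (hm : 0 < m)
    (hconc : RestrictedStronglyConcave u m (Omega n (2 * s) (2 * s))) {X : Finset (Fin n)}
    (hX : X.card ≤ s) (R : Finset (Fin n)) :
    m / 2 * normSqOn (maximizer u X) R ≤ sparseObjective u X := by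
  obtain ⟨hw, hmax⟩ := maximizer_spec hu.continuous hm hconc (X := X) (by omega)
  rw [sparseObjective_eq hw hmax]
  set w := maximizer u X with hwdef
  have hw0 := mem_supportedOn.1 hw
  have hc := hconc w 0 ⟨(card_supp_le hw0).trans (by omega), by simp [supp],
    (card_supp_le (X := X) fun i hi => by simp [hw0 i hi]).trans (by omega)⟩
  have hin : inner ℝ (gradient u w) (0 - w) = (0 : ℝ) := by
    rw [inner_eq_sum]
    refine Finset.sum_eq_zero fun i _ => ?_
    by_cases hi : i ∈ X
    · rw [gradient_eq_zero_of_isMaxOn (hu.differentiable (by simp)) hw hmax hi, zero_mul]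
    · simp [hw0 i hi]
  rw [hin, zero_sub, norm_neg, norm_sq_eq_sum] at hc
  have hle : normSqOn w R ≤ ∑ i, w i ^ 2 :=
    Finset.sum_le_sum_of_subset_of_nonneg (Finset.subset_univ R) fun i _ _ => sq_nonneg _
  have := mul_le_mul_of_nonneg_left hle (by positivity : 0 ≤ m / 2)
  linarith

/-- The pair of 0 and a unit vector lies in both domains; comparing the two bounds there gives m ≤
M, and hence M > 0 when m > 0. -/
lemma concavity_le_smoothness (i : Fin n) (hs : 0 < s) (ht : 0 < t)
    (hconc : RestrictedStronglyConcave u m (Omega n (2 * s) (2 * s)))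
    (hsmooth : RestrictedSmooth u M (Omega n s t)) : m ≤ M := by
  set e : EuclideanSpace ℝ (Fin n) := EuclideanSpace.single i 1 with he
  have hsupp : (supp e).card ≤ 1 := by
    refine (card_supp_le (X := {i}) fun j hj => ?_).trans (by simp)
    simp [he, Finset.mem_singleton.not.1 hj]
  have hsupp' : (supp (0 - e)).card ≤ 1 := by
    refine (card_supp_le (X := {i}) fun j hj => ?_).trans (by simp)
    simp [he, Finset.mem_singleton.not.1 hj]
  have h1 := hconc 0 e ⟨by simp [supp], hsupp.trans (by omega), hsupp'.trans (by omega)⟩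
  have h2 := hsmooth 0 e ⟨by simp [supp], hsupp.trans hs, hsupp'.trans ht⟩
  have hnorm : ‖e - 0‖ ^ 2 = 1 := by simp [he]
  rw [hnorm] at h1 h2
  linarith

end Analysis

/-! ### From cheap families to averaged scores -/

section Reachability

variable {n : ℕ}

lemma HasCheapFamily.mono {V : Type} [DecidableEq V] {feas feas' : Finset V → Finset V → Prop}
    {X Y : Finset V} {q k : ℝ} {c : V → ℝ} (h : HasCheapFamily feas X Y q k c)
    (himp : ∀ A B, A ⊆ Y \ X → B ⊆ X \ Y → feas A B → feas' A B) :
    HasCheapFamily feas' X Y q k c := by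
  obtain ⟨ι, _, w, A, B, hw, hA, hB, hfeas, hcov, hcost⟩ := h
  exact ⟨ι, inferInstance, w, A, B, hw, hA, hB, fun i => himp _ _ (hA i) (hB i) (hfeas i), hcov,
    hcost⟩

lemma union_sdiff_of_exchange {X Y A B : Finset (Fin n)} (hA : A ⊆ Y \ X) (hB : B ⊆ X) :
    (X ∪ A) \ B = X \ B ∪ A ∧ ((X ∪ A) \ B) \ X = A ∧ X \ ((X ∪ A) \ B) = B := by
  refine ⟨?_, ?_, ?_⟩ <;>
  · ext x
    have h1 := @hA x
    have h2 := @hB x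
    simp only [Finset.mem_union, Finset.mem_sdiff] at h1 h2 ⊢
    tauto

lemma ConstraintKind.maxAdd_add_maxRemove {κ : ConstraintKind} {p q : ℕ} (hp : 2 ≤ p) :
    κ.maxAdd q + κ.maxRemove p q = κ.exchangeSize p q := by
  cases κ
  · simp only [maxAdd, maxRemove, exchangeSize]; ring
  · simp only [maxAdd, maxRemove, exchangeSize]
    have : q ≤ p * q := Nat.le_mul_of_pos_left q (by omega)
    omega

/-- Both kinds of constraint admit cheap families of reachable exchanges. -/
theorem cheapFamily_reachable {κ : ConstraintKind} {p q : ℕ} (hp : 2 ≤ p) (hq : 1 ≤ q)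
    {I : Set (Finset (Fin n))} (hI : κ.Holds p I) {X Y : Finset (Fin n)} (hX : X ∈ I)
    (hY : Y ∈ I) {c : Fin n → ℝ} (hc : ∀ x, 0 ≤ c x) :
    HasCheapFamily (fun A B => (X ∪ A) \ B ∈ reachable κ p q I X) X Y q ((p - 1) * q + 1) c := by
  cases κ with
  | matroidIntersection =>
    obtain ⟨-, 𝓜, hE, hmem⟩ := hI
    refine (cheapFamily_matroids hp hq 𝓜 hE ((hmem X).1 hX) ((hmem Y).1 hY) hc).mono ?_
    rintro A B hA hB ⟨hAc, hBc, hind⟩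
    obtain ⟨h1, h2, h3⟩ := union_sdiff_of_exchange hA (hB.trans Finset.sdiff_subset)
    refine ⟨?_, ?_, ?_⟩
    · rw [h1]; exact (hmem _).2 hind
    · rw [h2]; simp only [ConstraintKind.maxAdd]; omega
    · rw [h3]; simp only [ConstraintKind.maxRemove]; nlinarith
  | exchangeSystem =>
    obtain ⟨-, hex⟩ := hI
    obtain ⟨φ, hφ, hφp, hφp', hφI⟩ := hex X hX Y hY
    refine (cheapFamily_of_degree_le hp hq φ hφ hφp hφp' hc).mono ?_
    rintro A B hA hB ⟨hAc, hBc, hBA⟩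
    obtain ⟨h1, h2, h3⟩ := union_sdiff_of_exchange hA (hB.trans Finset.sdiff_subset)
    refine ⟨?_, ?_, ?_⟩
    · rw [h1, hBA]; exact hφI A hA
    · rw [h2]; exact hAc
    · rw [h3]
      simp only [ConstraintKind.maxRemove]
      rwa [Nat.sub_mul, one_mul] at hBc

/-- An upper bound for the surrogate gains of all exchanges of a cheap family bounds the total
surrogate gain. -/
lemma HasCheapFamily.score_le {feas : Finset (Fin n) → Finset (Fin n) → Prop}
    {X Y : Finset (Fin n)} {q : ℕ} {k : ℝ} {g w : EuclideanSpace ℝ (Fin n)}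
    (h : HasCheapFamily feas X Y q k fun i => w i ^ 2) {a b Γ : ℝ} (hb : 0 ≤ b)
    (hΓ : 0 ≤ Γ) (hgain : ∀ A B, A ⊆ Y \ X → B ⊆ X \ Y → feas A B →
      a * normSqOn g A - b * normSqOn w B ≤ Γ) :
    q * (a * normSqOn g (Y \ X)) - k * (b * normSqOn w (X \ Y)) ≤ q * ((Y \ X).card * Γ) := by
  classical
  obtain ⟨ι, _, v, A, B, hv, hA, hB, hfeas, hcov, hcost⟩ := h
  have hcount : ∀ f : Fin n → ℝ, ∑ i, v i * ∑ x ∈ A i, f x = q * ∑ x ∈ Y \ X, f x := by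
    intro f
    calc ∑ i, v i * ∑ x ∈ A i, f x = ∑ i, ∑ x ∈ Y \ X, f x * (if x ∈ A i then v i else 0) := by
          refine Finset.sum_congr rfl fun i _ => ?_
          simp only [mul_ite, mul_zero]
          rw [Finset.sum_ite_mem, Finset.inter_eq_right.2 (hA i), Finset.mul_sum]
          exact Finset.sum_congr rfl fun b _ => mul_comm _ _
      _ = ∑ x ∈ Y \ X, f x * ∑ i, (if x ∈ A i then v i else 0) := by
          rw [Finset.sum_comm]
          exact Finset.sum_congr rfl fun b _ => (Finset.mul_sum _ _ _).symm
      _ = ∑ x ∈ Y \ X, f x * q := Finset.sum_congr rfl fun x hx => by rw [hcov x hx]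
      _ = q * ∑ x ∈ Y \ X, f x := by rw [← Finset.sum_mul, mul_comm]
  -- Charging Γ to each added element makes the right side computable from the covering alone. An
  -- exchange that adds nothing has a nonpositive score; otherwise |A i| ≥ 1.
  have hone : ∀ i, v i * (a * normSqOn g (A i) - b * normSqOn w (B i)) ≤
      v i * ((A i).card * Γ) := by
    intro i
    refine mul_le_mul_of_nonneg_left ?_ (hv i)
    rcases (A i).eq_empty_or_nonempty with hemp | hne
    · rw [hemp]
      have := mul_nonneg hb (normSqOn_nonneg w (B i))
      simp only [normSqOn, Finset.sum_empty, Finset.card_empty, Nat.cast_zero, zero_mul] at this ⊢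
      linarith
    · have h1 : (1 : ℝ) ≤ (A i).card := by exact_mod_cast hne.card_pos
      nlinarith [hgain _ _ (hA i) (hB i) (hfeas i)]
  have hsum := Finset.sum_le_sum fun i (_ : i ∈ (Finset.univ : Finset ι)) => hone i
  have e1 : ∑ i, v i * (a * normSqOn g (A i) - b * normSqOn w (B i)) =
      a * ∑ i, v i * ∑ x ∈ A i, g x ^ 2 - b * ∑ i, v i * ∑ x ∈ B i, w x ^ 2 := by
    rw [Finset.mul_sum, Finset.mul_sum, ← Finset.sum_sub_distrib]
    exact Finset.sum_congr rfl fun i _ => by simp only [normSqOn]; ring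
  have e2 : ∑ i, v i * ((A i).card * Γ) = q * ((Y \ X).card * Γ) := by
    have := hcount fun _ => Γ
    simpa only [Finset.sum_const, nsmul_eq_mul] using this
  rw [e1, e2, hcount] at hsum
  have h3 := mul_le_mul_of_nonneg_left hcost hb
  simp only [normSqOn]
  linarith

end Reachability

/-! ### Progress of one iteration and the guarantee -/

section Algorithm

variable {n : ℕ}

/-- The quantity that is tested. -/
noncomputable def Variant.gain (a : Variant) (u : EuclideanSpace ℝ (Fin n) → ℝ) (M : ℝ)
    (X X' : Finset (Fin n)) : ℝ :=
  match a with
  | .semiOblivious => sparseObjective u X' - sparseObjective u X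
  | .nonOblivious => score u M X X'

lemma Variant.improves_iff (a : Variant) (u : EuclideanSpace ℝ (Fin n) → ℝ) (M : ℝ)
    (X X' : Finset (Fin n)) : a.Improves u M X X' ↔ 0 < a.gain u M X X' := by
  cases a <;> exact Iff.rfl

lemma Variant.Selects.mem {a : Variant} {u : EuclideanSpace ℝ (Fin n) → ℝ} {M : ℝ}
    {F : Set (Finset (Fin n))} {X X' : Finset (Fin n)} (h : a.Selects u M F X X') : X' ∈ F := by
  cases a with
  | semiOblivious =>
    obtain ⟨φ, -, h, -⟩ := h
    exact h.1
  | nonOblivious => exact h.1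

variable {κ : ConstraintKind} {p q s : ℕ} {I : Set (Finset (Fin n))}
  {u : EuclideanSpace ℝ (Fin n) → ℝ} {m M : ℝ}

lemma add_score_le_of_reachable (hp : 2 ≤ p) (hs : ∀ Y ∈ I, Y.card ≤ s)
    (hu : ContDiff ℝ 1 u) (hm : 0 < m) (hM : 0 < M)
    (hconc : RestrictedStronglyConcave u m (Omega n (2 * s) (2 * s)))
    (hsmooth : RestrictedSmooth u M (Omega n s (κ.exchangeSize p q))) {X X' : Finset (Fin n)}
    (hX : X ∈ I) (hX' : X' ∈ reachable κ p q I X) :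
    sparseObjective u X + score u M X X' ≤ sparseObjective u X' := by
  obtain ⟨h1, h2, h3⟩ := hX'
  refine add_score_le_sparseObjective hu hm hM hconc hsmooth (hs X hX) (hs X' h1) ?_
  rw [← ConstraintKind.maxAdd_add_maxRemove hp]
  exact add_le_add h2 h3

/-- The gain of the selected set dominates the surrogate gains of all reachable exchanges. -/
lemma Variant.Selects.score_le_gain {a : Variant} (hp : 2 ≤ p) (hs : ∀ Y ∈ I, Y.card ≤ s)
    (hu : ContDiff ℝ 1 u) (hm : 0 < m) (hM : 0 < M)
    (hconc : RestrictedStronglyConcave u m (Omega n (2 * s) (2 * s)))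
    (hsmooth : RestrictedSmooth u M (Omega n s (κ.exchangeSize p q))) {X X' : Finset (Fin n)}
    (hX : X ∈ I) (hsel : a.Selects u M (reachable κ p q I X) X X') {Y A B : Finset (Fin n)}
    (hA : A ⊆ Y \ X) (hB : B ⊆ X) (hAB : (X ∪ A) \ B ∈ reachable κ p q I X) :
    1 / (2 * M) * normSqOn (gradient u (maximizer u X)) A -
      M / 2 * normSqOn (maximizer u X) B ≤ a.gain u M X X' := by
  cases a with
  | nonOblivious =>
    have h := hsel.2 _ hAB
    obtain ⟨-, h2, h3⟩ := union_sdiff_of_exchange hA hB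
    rw [score, h2, h3] at h
    exact h
  | semiOblivious =>
    obtain ⟨φ, ⟨hφX, hφ⟩, -, hmax⟩ := hsel
    -- The oblivious removal for A is no heavier than B, so its score is at least that of (A, B),
    -- and its true gain is at least its own score.
    obtain ⟨hmem, hle⟩ := hφ A B hB hAB
    obtain ⟨-, h2, h3⟩ := union_sdiff_of_exchange hA (hφX A)
    have h4 := add_score_le_of_reachable hp hs hu hm hM hconc hsmooth hX hmem
    rw [score, h2, h3] at h4
    have h5 := hmax _ hmem ⟨A, rfl⟩
    have h6 := mul_le_mul_of_nonneg_left hle (by positivity : 0 ≤ M / 2)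
    simp only [gain]
    linarith

/-- The empty exchange is reachable and has score 0. -/
lemma Variant.Selects.gain_nonneg {a : Variant} (hp : 2 ≤ p) (hs : ∀ Y ∈ I, Y.card ≤ s)
    (hu : ContDiff ℝ 1 u) (hm : 0 < m) (hM : 0 < M)
    (hconc : RestrictedStronglyConcave u m (Omega n (2 * s) (2 * s)))
    (hsmooth : RestrictedSmooth u M (Omega n s (κ.exchangeSize p q))) {X X' : Finset (Fin n)}
    (hX : X ∈ I) (hsel : a.Selects u M (reachable κ p q I X) X X') : 0 ≤ a.gain u M X X' := by
  have := hsel.score_le_gain hp hs hu hm hM hconc hsmooth hX (Y := ∅) (A := ∅) (B := ∅)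
    (Finset.empty_subset _) (Finset.empty_subset _) (by
      rw [Finset.union_empty, Finset.sdiff_empty]
      exact ⟨hX, by simp, by simp⟩)
  simpa [normSqOn] using this

lemma Variant.Selects.add_gain_le {a : Variant} (hp : 2 ≤ p) (hs : ∀ Y ∈ I, Y.card ≤ s)
    (hu : ContDiff ℝ 1 u) (hm : 0 < m) (hM : 0 < M)
    (hconc : RestrictedStronglyConcave u m (Omega n (2 * s) (2 * s)))
    (hsmooth : RestrictedSmooth u M (Omega n s (κ.exchangeSize p q))) {X X' : Finset (Fin n)}
    (hX : X ∈ I) (hsel : a.Selects u M (reachable κ p q I X) X X') :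
    sparseObjective u X + a.gain u M X X' ≤ sparseObjective u X' := by
  cases a with
  | semiOblivious => simp [gain]
  | nonOblivious =>
    exact add_score_le_of_reachable hp hs hu hm hM hconc hsmooth hX hsel.mem

/-- The progress of one iteration. -/
lemma Variant.Selects.progress {a : Variant} (hp : 2 ≤ p) (hq : 1 ≤ q) (hI : κ.Holds p I)
    (hs : ∀ Y ∈ I, Y.card ≤ s) (hu : ContDiff ℝ 1 u) (hu0 : 0 ≤ u 0) (hm : 0 < m) (hmM : m ≤ M)
    (hconc : RestrictedStronglyConcave u m (Omega n (2 * s) (2 * s)))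
    (hsmooth : RestrictedSmooth u M (Omega n s (κ.exchangeSize p q)))
    {X X' Y : Finset (Fin n)} (hX : X ∈ I) (hY : Y ∈ I)
    (hsel : a.Selects u M (reachable κ p q I X) X X') :
    m / M * sparseObjective u Y - ((p : ℝ) - 1 + 1 / q) * M / m * sparseObjective u X ≤
      s * a.gain u M X X' := by
  have hM : 0 < M := hm.trans_le hmM
  have hq0 : (0 : ℝ) < q := by exact_mod_cast hq
  have hp2 : (2 : ℝ) ≤ p := by exact_mod_cast hp
  set Γ := a.gain u M X X' with hΓdef
  set g := gradient u (maximizer u X) with hg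
  set w := maximizer u X with hw
  set r : ℝ := (p : ℝ) - 1 + 1 / q with hr
  have hr1 : 1 ≤ r := by
    have : (0 : ℝ) < 1 / q := by positivity
    linarith
  have hΓ : 0 ≤ Γ := hsel.gain_nonneg hp hs hu hm hM hconc hsmooth hX
  have h1 := (cheapFamily_reachable hp hq hI hX hY (c := fun i => w i ^ 2)
    fun i => sq_nonneg _).score_le (g := g) (a := 1 / (2 * M)) (b := M / 2) (Γ := Γ)
    (by positivity) hΓ fun A B hA hB hAB =>
      hsel.score_le_gain hp hs hu hm hM hconc hsmooth hX hA (hB.trans Finset.sdiff_subset) hAB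
  set G := normSqOn g (Y \ X) with hG
  set W := normSqOn w (X \ Y) with hW
  have hcard : ((Y \ X).card : ℝ) ≤ s := by
    exact_mod_cast (Finset.card_le_card Finset.sdiff_subset).trans (hs Y hY)
  have h2 : 1 / (2 * M) * G - r * (M / 2 * W) ≤ s * Γ := by
    have hkr : ((p : ℝ) - 1) * q + 1 = q * r := by
      rw [hr]; field_simp
    rw [hkr, mul_assoc, ← mul_sub] at h1
    exact (le_of_mul_le_mul_left h1 hq0).trans (mul_le_mul_of_nonneg_right hcard hΓ)
  have h3 : sparseObjective u Y ≤ sparseObjective u X + 1 / (2 * m) * G - m / 2 * W :=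
    sparseObjective_le_add hu hm hconc (hs X hX) (hs Y hY)
  have h4 : m / 2 * W ≤ sparseObjective u X :=
    normSqOn_maximizer_le hu hu0 hm hconc (hs X hX) _
  refine le_trans ?_ h2
  have h5 : m / M * (sparseObjective u Y - sparseObjective u X + m / 2 * W) ≤
      1 / (2 * M) * G := by
    have : 1 / (2 * M) * G = m / M * (1 / (2 * m) * G) := by field_simp
    rw [this]
    exact mul_le_mul_of_nonneg_left (by linarith) (by positivity)
  -- This raises the coefficient of f(X) - (m/2)W from m/M to rM/m, which merges the f(X) and W
  -- terms into the single bound r(M/m) f(X). It needs r ≥ 1 and m ≤ M.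
  have h6 : 0 ≤ (r * M / m - m / M) * (sparseObjective u X - m / 2 * W) := by
    refine mul_nonneg (sub_nonneg.2 ?_) (by linarith)
    rw [div_le_div_iff₀ hM hm]
    nlinarith [mul_le_mul hmM hmM hm.le hM.le, mul_pos hM hM]
  have h7 : r * M / m * (m / 2 * W) = r * (M / 2 * W) := by field_simp
  nlinarith

/-- The guarantee for a run of the algorithm. -/
lemma LocalSearch.guarantee {a : Variant} (hp : 2 ≤ p) (hq : 1 ≤ q) (hI : κ.Holds p I)
    (hs : ∀ Y ∈ I, Y.card ≤ s) (hs0 : 0 < s) (hu : ContDiff ℝ 1 u) (hu0 : 0 ≤ u 0) (hm : 0 < m)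
    (hmM : m ≤ M) (hconc : RestrictedStronglyConcave u m (Omega n (2 * s) (2 * s)))
    (hsmooth : RestrictedSmooth u M (Omega n s (κ.exchangeSize p q)))
    {Xstar : Finset (Fin n)} (hstar : Xstar ∈ I) {T : ℕ} {X₀ X : Finset (Fin n)} {o : Outcome}
    (hX₀ : X₀ ∈ I) (hrun : LocalSearch a κ p q I u M T X₀ X o) :
    1 / ((p : ℝ) - 1 + 1 / q) * (m ^ 2 / M ^ 2) * sparseObjective u Xstar - sparseObjective u X ≤
        Real.exp (-(((p : ℝ) - 1 + 1 / q) * M / (s * m) * T)) *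
          max (1 / ((p : ℝ) - 1 + 1 / q) * (m ^ 2 / M ^ 2) * sparseObjective u Xstar -
            sparseObjective u X₀) 0 ∧
      (o = Outcome.stopped →
        1 / ((p : ℝ) - 1 + 1 / q) * (m ^ 2 / M ^ 2) * sparseObjective u Xstar ≤
          sparseObjective u X) := by
  have hM : 0 < M := hm.trans_le hmM
  have hq0 : (0 : ℝ) < q := by exact_mod_cast hq
  have hp2 : (2 : ℝ) ≤ p := by exact_mod_cast hp
  have hs' : (0 : ℝ) < s := by exact_mod_cast hs0
  have hprog : ∀ X X', X ∈ I → a.Selects u M (reachable κ p q I X) X X' → _ :=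
    fun X X' hX hsel => hsel.progress hp hq hI hs hu hu0 hm hmM hconc hsmooth hX hstar
  set r : ℝ := (p : ℝ) - 1 + 1 / q with hr
  have hr0 : 0 < r := by
    have : (0 : ℝ) < 1 / q := by positivity
    linarith
  set C := 1 / r * (m ^ 2 / M ^ 2) * sparseObjective u Xstar with hC
  set ρ := r * M / (s * m) with hρ
  have hρ0 : 0 < ρ := by positivity
  have hprog' : ∀ X X', X ∈ I → a.Selects u M (reachable κ p q I X) X X' →
      ρ * (C - sparseObjective u X) ≤ a.gain u M X X' := by
    intro X X' hX hsel
    have h := hprog X X' hX hsel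
    have he : m / M * sparseObjective u Xstar - r * M / m * sparseObjective u X =
        s * (ρ * (C - sparseObjective u X)) := by
      rw [hρ, hC]; field_simp
    rw [he] at h
    exact le_of_mul_le_mul_left h hs'
  induction hrun with
  | finish X => simp
  | halt T X X' hsel himp =>
    have h := hprog' X X' hX₀ hsel
    rw [Variant.improves_iff, not_lt] at himp
    have hle : C - sparseObjective u X ≤ 0 := by
      by_contra hcon
      have := mul_pos hρ0 (not_le.1 hcon)
      linarith
    exact ⟨hle.trans (by positivity), fun _ => by linarith⟩
  | step T X X' Y o hsel himp hrest ih =>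
    obtain ⟨ih1, ih2⟩ := ih hsel.mem.1
    refine ⟨ih1.trans ?_, ih2⟩
    have h := hprog' X X' hX₀ hsel
    rw [Variant.improves_iff] at himp
    have hadd := hsel.add_gain_le hp hs hu hm hM hconc hsmooth hX₀
    have hexp : Real.exp (-(ρ * ((T + 1 : ℕ) : ℝ))) = Real.exp (-(ρ * T)) * Real.exp (-ρ) := by
      rw [← Real.exp_add]; congr 1; push_cast; ring
    rw [hexp, mul_assoc]
    refine mul_le_mul_of_nonneg_left (max_le ?_ (by positivity)) (Real.exp_pos _).le
    -- The maximum with 0 covers starting points that already exceed C: the value never decreases,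
    -- so the deficit stays nonpositive. It also avoids any assumption on the sign of 1 - ρ.
    rcases le_total (C - sparseObjective u X) 0 with hneg | hpos
    · have : C - sparseObjective u X' ≤ 0 := by linarith
      exact this.trans (by positivity)
    · rw [max_eq_left hpos]
      have h1 : 1 - ρ ≤ Real.exp (-ρ) := by linarith [Real.add_one_le_exp (-ρ)]
      nlinarith [mul_le_mul_of_nonneg_right h1 hpos]

end Algorithm

end SparseLocalSearch

theorem mainTheorem5 {n : ℕ} (κ : ConstraintKind) (a : Variant)
    (p q s T : ℕ) (hp : 2 ≤ p) (hq : 1 ≤ q)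
    (I : Set (Finset (Fin n))) (hI : κ.Holds p I)
    (hs : IsGreatest (Finset.card '' I) s) (hs0 : 0 < s)
    (u : EuclideanSpace ℝ (Fin n) → ℝ) (hu : ContDiff ℝ 1 u) (hu0 : 0 ≤ u 0)
    (m M : ℝ) (hm : 0 < m)
    (hconc : RestrictedStronglyConcave u m (Omega n (2 * s) (2 * s)))
    (hsmooth : RestrictedSmooth u M (Omega n s (κ.exchangeSize p q)))
    (Xstar : Finset (Fin n)) (hstar : Xstar ∈ I)
    (hopt : ∀ Y ∈ I, sparseObjective u Y ≤ sparseObjective u Xstar)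
    (X₀ : Finset (Fin n)) (hX₀ : X₀ ∈ I)
    (X : Finset (Fin n)) (o : Outcome) (hrun : LocalSearch a κ p q I u M T X₀ X o) :
    sparseObjective u X ≥
        1 / ((p : ℝ) - 1 + 1 / (q : ℝ)) * (m ^ 2 / M ^ 2)
          * (1 - Real.exp (-(((p : ℝ) - 1 + 1 / (q : ℝ)) * M * (T : ℝ) / ((s : ℝ) * m))))
          * sparseObjective u Xstar ∧
      (o = Outcome.stopped →
        sparseObjective u X ≥
          1 / ((p : ℝ) - 1 + 1 / (q : ℝ)) * (m ^ 2 / M ^ 2) * sparseObjective u Xstar) := by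
  have hcard : ∀ Y ∈ I, Y.card ≤ s := fun Y hY => hs.2 ⟨Y, hY, rfl⟩
  have hmM : m ≤ M := by
    obtain ⟨Z, -, hZs⟩ := hs.1
    obtain ⟨i, -⟩ : Z.Nonempty := Finset.card_pos.1 (by omega)
    refine concavity_le_smoothness i hs0 ?_ hconc hsmooth
    cases κ
    · simp only [ConstraintKind.exchangeSize]; positivity
    · simp only [ConstraintKind.exchangeSize]; positivity
  obtain ⟨h1, h2⟩ := hrun.guarantee hp hq hI hcard hs0 hu hu0 hm hmM hconc hsmooth hstar hX₀
  refine ⟨?_, h2⟩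
  have hnonneg : ∀ Y ∈ I, 0 ≤ sparseObjective u Y := fun Y hY => by
    simpa [normSqOn] using normSqOn_maximizer_le hu hu0 hm hconc (hcard Y hY) ∅
  have hr : (0 : ℝ) < (p : ℝ) - 1 + 1 / q := by
    have : (2 : ℝ) ≤ p := by exact_mod_cast hp
    have : (0 : ℝ) < 1 / q := by
      have : (0 : ℝ) < q := by exact_mod_cast hq
      positivity
    linarith
  set C := 1 / ((p : ℝ) - 1 + 1 / q) * (m ^ 2 / M ^ 2) * sparseObjective u Xstar with hC
  have hC0 : 0 ≤ C := mul_nonneg (by positivity) (hnonneg _ hstar)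
  -- Since f(X₀) ≥ 0, the initial deficit is at most C, which produces the factor 1 - exp(...).
  have hmax : max (C - sparseObjective u X₀) 0 ≤ C :=
    max_le (by linarith [hnonneg _ hX₀]) hC0
  have he : ((p : ℝ) - 1 + 1 / q) * M / (s * m) * T = ((p : ℝ) - 1 + 1 / q) * M * T / (s * m) := by
    ring
  rw [he] at h1
  set E := Real.exp (-(((p : ℝ) - 1 + 1 / q) * M * T / (s * m))) with hE
  have h3 := h1.trans (mul_le_mul_of_nonneg_left hmax (Real.exp_pos _).le)
  have h4 : 1 / ((p : ℝ) - 1 + 1 / q) * (m ^ 2 / M ^ 2) * (1 - E) * sparseObjective u Xstar =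
      C - E * C := by
    rw [hC]; ring
  rw [h4]
  linarith
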